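/- For each $m\in\{1,2,\dots\}$ let $Y_1,\dots,Y_m$ (depending on $m$) satisfy, independently for $i=1,\dots,m$, $Y_i = X_i\beta_m + Z_iU_i+E_i$, where $X_i\in\mathbb R^{n_i\times p_m}$ and $Z_i\in\mathbb R^{n_i\times q_m}$ ($q_m\ge 1$) are non-stochastic, and $U_i\sim \mathrm N(0,\Psi_1(\psi_m))$ and $E_i\sim \mathrm N(0,\psi_{mr}I_{n_i})$ are independent. Here $\psi_m\in\mathbb R^{r_m}$, $r_m=q_m(q_m+1)/2+1$; $\psi_{mr}$ is its last element; $\Psi_1(\psi)$ is the symmetric $q_m\times q_m$ matrix whose half-vectorization consists of the other elements of $\psi$; and $\psi_m\in\mathbb P_m=\{\psi: \Psi_1(\psi)\succeq 0,\ \psi_r>0\}$. All dimensions, matrices and parameters may depend on $m$. Write $n=\sum_i n_i$, $\bar n=n/m$, $Y=[Y_1^T,\dots,Y_m^T]^T$, $X=[X_1^T,\dots,X_m^T]^T$, $Z=\mathrm{bdiag}(Z_1,\dots,Z_m)$, $\theta=(\beta,\psi)$, $\theta_m=(\beta_m,\psi_m)$, so that $Y\sim \mathrm N(X\beta_m,\Sigma(\psi_m))$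 with $\Sigma(\psi)=Z\{I_m\otimes\Psi_1(\psi)\}Z^T+\psi_rI_n$. Let $S_m(\theta)$ be the gradient in $\theta$ of the log-likelihood $-\frac12\{\log|\Sigma(\psi)|+(Y-X\beta)^T\Sigma(\psi)^{-1}(Y-X\beta)\}$, $\mathcal I_m(\theta)=\mathrm{cov}_\theta\{S_m(\theta)\}$, and $W^S_m(\theta)=\mathcal I_m(\theta)^{-1/2}S_m(\theta)$. Assume that there are constants $c_1>1$ and $c_2>1$, not depending on $m$, such that for every $m$: (i) $\bar n/q_m\ge c_1$; (ii) all eigenvalues of $Z_i^TZ_i$ lie in $[c_2^{-1},c_2]$ for every $i\in\{1,\dots,m\}$; (iv) $X$ has full column rank $p_m$; and that (v) $\|\psi_m\|/\psi_{mr}=o(m^{1/2})$ as $m\to\infty$. Then $\mathcal I_m(\theta_m)$ is positive definite for every $m\ge 1$ and, for any $u_m\in\mathbb R^{p_m+r_m}$ with $\|u_m\|=1$, $u_m^TW^S_m(\theta_m)\to \mathrm N(0,1)$ in distribution as $m\to\infty$. Suppose in addition that (iii') $p_m/m\to0$. Let $V=V_m\in\mathbb R^{n\times(n-p_m)}$ satisfy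 $V^TV=I$ and $V^TX=0$, and let $\tilde S_m(\psi)$, $\tilde{\mathcal I}_m(\psi)$ and $\tilde W^S_m(\psi)=\tilde{\mathcal I}_m(\psi)^{-1/2}\tilde S_m(\psi)$ be the score, its covariance matrix and the standardized score for $\psi$ in the model $\tilde Y=V^TY\sim\mathrm N(0,V^T\Sigma(\psi)V)$. Then $\tilde{\mathcal I}_m(\psi_m)$ is positive definite for all large $m$ and, for any $v_m\in\mathbb R^{r_m}$ with $\|v_m\|=1$, $v_m^T\tilde W^S_m(\psi_m)\to\mathrm N(0,1)$ in distribution as $m\to\infty$. -/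

import Mathlib

open MeasureTheory ProbabilityTheory Filter Topology Asymptotics Matrix WithLp
open scoped MatrixOrder

noncomputable section

namespace LMM

/-! ### Score, information and standardized score of a Gaussian family

A family of normal distributions `N(μ(θ), S(θ))` on `ℝ^N`, with `θ ∈ ℝ^ι`. -/

section GaussianFamily

variable {N ι : Type*} [Fintype N] [DecidableEq N] [Fintype ι] [DecidableEq ι]

/-- The log-likelihood (up to an additive constant)
`-(1/2) {log |S(θ)| + (y - μ(θ))ᵀ S(θ)⁻¹ (y - μ(θ))}`. -/
def logLik (μ : EuclideanSpace ℝ ι → EuclideanSpace ℝ N)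
    (S : EuclideanSpace ℝ ι → Matrix N N ℝ) (θ : EuclideanSpace ℝ ι)
    (y : EuclideanSpace ℝ N) : ℝ :=
  -(1 / 2) * (Real.log (S θ).det + ofLp (y - μ θ) ⬝ᵥ ((S θ)⁻¹ *ᵥ ofLp (y - μ θ)))

/-- The score: the gradient of the log-likelihood with respect to the parameter. -/
def score (μ : EuclideanSpace ℝ ι → EuclideanSpace ℝ N)
    (S : EuclideanSpace ℝ ι → Matrix N N ℝ) (θ : EuclideanSpace ℝ ι)
    (y : EuclideanSpace ℝ N) : EuclideanSpace ℝ ι :=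
  gradient (fun θ' => logLik μ S θ' y) θ

/-- The Fisher information: the covariance matrix of the score at `θ` when the data are
distributed according to `θ`. -/
def fisherInfo (μ : EuclideanSpace ℝ ι → EuclideanSpace ℝ N)
    (S : EuclideanSpace ℝ ι → Matrix N N ℝ) (θ : EuclideanSpace ℝ ι) : Matrix ι ι ℝ :=
  Matrix.of fun i j =>
    cov[fun y => score μ S θ y i, fun y => score μ S θ y j; multivariateGaussian (μ θ) (S θ)]

/-- The standardized score `I(θ)^{-1/2} S(θ)`, where `I(θ)^{-1/2}` is the inverse of the positive
semidefinite square root of the Fisher information. -/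
def stdScore (μ : EuclideanSpace ℝ ι → EuclideanSpace ℝ N)
    (S : EuclideanSpace ℝ ι → Matrix N N ℝ) (θ : EuclideanSpace ℝ ι)
    (y : EuclideanSpace ℝ N) : EuclideanSpace ℝ ι :=
  toLp 2 ((CFC.sqrt (fisherInfo μ S θ))⁻¹ *ᵥ ofLp (score μ S θ y))

end GaussianFamily

/-! ### Covariance parameters -/

/-- Indices of the covariance parameter `ψ ∈ ℝ^r`, `r = q (q + 1) / 2 + 1`: the positions in the
lower triangle of a `q × q` matrix, and one further index for the error variance. -/
abbrev VarIdx (q : ℕ) : Type := {ij : Fin q × Fin q // ij.2 ≤ ij.1} ⊕ Unit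

/-- The error variance `ψ_r`. -/
def errVar {q : ℕ} (ψ : EuclideanSpace ℝ (VarIdx q)) : ℝ := ψ (Sum.inr ())

/-- The symmetric matrix `Ψ₁(ψ)` whose half-vectorization consists of all elements of `ψ` but
the last. -/
def Psi1 {q : ℕ} (ψ : EuclideanSpace ℝ (VarIdx q)) : Matrix (Fin q) (Fin q) ℝ :=
  Matrix.of fun i j => ψ (Sum.inl ⟨(max i j, min i j), min_le_max⟩)

/-- The parameter set `{ψ : Ψ₁(ψ) ≥ 0, ψ_r > 0}`. -/
def paramSet (q : ℕ) : Set (EuclideanSpace ℝ (VarIdx q)) :=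
  {ψ | (Psi1 ψ).PosSemidef ∧ 0 < errVar ψ}

/-! ### The linear mixed model with independent clusters -/

section Clusters

/-- Indices of all observations: pairs of a cluster `i` and an observation in that cluster. -/
abbrev ObsIdx {m : ℕ} (n : Fin m → ℕ) : Type := (i : Fin m) × Fin (n i)

variable {m p q : ℕ} {n : Fin m → ℕ}

/-- The stacked design matrix `X = [X₁ᵀ, …, X_mᵀ]ᵀ`. -/
def stackX (X : (i : Fin m) → Matrix (Fin (n i)) (Fin p) ℝ) : Matrix (ObsIdx n) (Fin p) ℝ :=
  Matrix.of fun k j => X k.1 k.2 j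

/-- The stacked response vector `Y = [Y₁ᵀ, …, Y_mᵀ]ᵀ`. -/
def stackY (Y : (i : Fin m) → EuclideanSpace ℝ (Fin (n i))) : EuclideanSpace ℝ (ObsIdx n) :=
  toLp 2 fun k => Y k.1 k.2

/-- The block-diagonal matrix `Z = bdiag(Z₁, …, Z_m)`. -/
def blockZ (Z : (i : Fin m) → Matrix (Fin (n i)) (Fin q) ℝ) :
    Matrix (ObsIdx n) ((_ : Fin m) × Fin q) ℝ :=
  Matrix.blockDiagonal' Z

/-- The covariance matrix `Ψ(ψ) = I_m ⊗ Ψ₁(ψ)` of all random effects. -/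
def Psi (m : ℕ) (ψ : EuclideanSpace ℝ (VarIdx q)) :
    Matrix ((_ : Fin m) × Fin q) ((_ : Fin m) × Fin q) ℝ :=
  Matrix.blockDiagonal' fun _ => Psi1 ψ

/-- The covariance matrix `Σ(ψ) = Z Ψ(ψ) Zᵀ + ψ_r I_n` of the responses. -/
def Sig (Z : (i : Fin m) → Matrix (Fin (n i)) (Fin q) ℝ) (ψ : EuclideanSpace ℝ (VarIdx q)) :
    Matrix (ObsIdx n) (ObsIdx n) ℝ :=
  blockZ Z * Psi m ψ * (blockZ Z)ᵀ + errVar ψ • 1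

/-- The full parameter `θ = (β, ψ) ∈ ℝ^(p + r)`. -/
def joinParam (β : EuclideanSpace ℝ (Fin p)) (ψ : EuclideanSpace ℝ (VarIdx q)) :
    EuclideanSpace ℝ (Fin p ⊕ VarIdx q) :=
  toLp 2 (Sum.elim (ofLp β) (ofLp ψ))

/-- The component `β` of `θ = (β, ψ)`. -/
def betaPart (θ : EuclideanSpace ℝ (Fin p ⊕ VarIdx q)) : EuclideanSpace ℝ (Fin p) :=
  toLp 2 fun j => θ (Sum.inl j)

/-- The component `ψ` of `θ = (β, ψ)`. -/
def psiPart (θ : EuclideanSpace ℝ (Fin p ⊕ VarIdx q)) : EuclideanSpace ℝ (VarIdx q) :=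
  toLp 2 fun j => θ (Sum.inr j)

/-- The mean `X β` of the responses, as a function of `θ`. -/
def meanY (X : (i : Fin m) → Matrix (Fin (n i)) (Fin p) ℝ)
    (θ : EuclideanSpace ℝ (Fin p ⊕ VarIdx q)) : EuclideanSpace ℝ (ObsIdx n) :=
  toLp 2 (stackX X *ᵥ ofLp (betaPart θ))

/-- The model: independently for `i = 1, …, m`, `Y_i = X_i β + Z_i U_i + E_i`, where
`U_i ∼ N(0, Ψ₁(ψ))` and `E_i ∼ N(0, ψ_r I)` are independent. -/
def IsClusterModel {Ω : Type*} [MeasurableSpace Ω] (P : Measure Ω)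
    (X : (i : Fin m) → Matrix (Fin (n i)) (Fin p) ℝ)
    (Z : (i : Fin m) → Matrix (Fin (n i)) (Fin q) ℝ)
    (β : EuclideanSpace ℝ (Fin p)) (ψ : EuclideanSpace ℝ (VarIdx q))
    (Y : (i : Fin m) → Ω → EuclideanSpace ℝ (Fin (n i))) : Prop :=
  ∃ (U : Fin m → Ω → EuclideanSpace ℝ (Fin q))
    (E : (i : Fin m) → Ω → EuclideanSpace ℝ (Fin (n i))),
    (∀ i, HasLaw (U i) (multivariateGaussian 0 (Psi1 ψ)) P) ∧
    (∀ i, HasLaw (E i) (multivariateGaussian 0 (errVar ψ • (1 : Matrix (Fin (n i)) (Fin (n i)) ℝ))) P) ∧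
    (∀ i, IndepFun (U i) (E i) P) ∧
    iIndepFun (fun i ω => (U i ω, E i ω)) P ∧
    ∀ i ω, Y i ω = toLp 2 (X i *ᵥ ofLp β + Z i *ᵥ ofLp (U i ω) + ofLp (E i ω))

/-! ### Full and restricted likelihood -/

/-- The Fisher information `I(θ)` of the model. -/
def info (X : (i : Fin m) → Matrix (Fin (n i)) (Fin p) ℝ)
    (Z : (i : Fin m) → Matrix (Fin (n i)) (Fin q) ℝ)
    (θ : EuclideanSpace ℝ (Fin p ⊕ VarIdx q)) : Matrix (Fin p ⊕ VarIdx q) (Fin p ⊕ VarIdx q) ℝ :=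
  fisherInfo (meanY X) (fun θ' => Sig Z (psiPart θ')) θ

/-- The standardized score `W^S(θ) = I(θ)^{-1/2} S(θ)` of the model. -/
def WS (X : (i : Fin m) → Matrix (Fin (n i)) (Fin p) ℝ)
    (Z : (i : Fin m) → Matrix (Fin (n i)) (Fin q) ℝ)
    (θ : EuclideanSpace ℝ (Fin p ⊕ VarIdx q)) (y : EuclideanSpace ℝ (ObsIdx n)) :
    EuclideanSpace ℝ (Fin p ⊕ VarIdx q) :=
  stdScore (meanY X) (fun θ' => Sig Z (psiPart θ')) θ y

variable {K : Type*} [Fintype K] [DecidableEq K]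

/-- `Σ̃(ψ) = Z̃ Ψ(ψ) Z̃ᵀ + ψ_r I` with `Z̃ = Vᵀ Z`. -/
def SigR (V : Matrix (ObsIdx n) K ℝ) (Z : (i : Fin m) → Matrix (Fin (n i)) (Fin q) ℝ)
    (ψ : EuclideanSpace ℝ (VarIdx q)) : Matrix K K ℝ :=
  (Vᵀ * blockZ Z) * Psi m ψ * (Vᵀ * blockZ Z)ᵀ + errVar ψ • 1

/-- The restricted information `Ĩ(ψ)`: the Fisher information of the model
`Ỹ = Vᵀ Y ∼ N(0, Σ̃(ψ))`. -/
def infoR (V : Matrix (ObsIdx n) K ℝ) (Z : (i : Fin m) → Matrix (Fin (n i)) (Fin q) ℝ)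
    (ψ : EuclideanSpace ℝ (VarIdx q)) : Matrix (VarIdx q) (VarIdx q) ℝ :=
  fisherInfo (fun _ => 0) (SigR V Z) ψ

/-- The standardized restricted score `W̃^S(ψ) = Ĩ(ψ)^{-1/2} S̃(ψ)`, evaluated at the data
`Ỹ = Vᵀ y`. -/
def WSR (V : Matrix (ObsIdx n) K ℝ) (Z : (i : Fin m) → Matrix (Fin (n i)) (Fin q) ℝ)
    (ψ : EuclideanSpace ℝ (VarIdx q)) (y : EuclideanSpace ℝ (ObsIdx n)) :
    EuclideanSpace ℝ (VarIdx q) :=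
  stdScore (fun _ => 0) (SigR V Z) ψ (toLp 2 (Vᵀ *ᵥ ofLp y))

end Clusters

end LMM

end

set_option linter.unusedSectionVars false

noncomputable section

namespace LMM

/-! ### Quadratic forms and positive semidefinite matrices -/

section MatrixFacts

variable {N K : Type*} [Fintype N] [DecidableEq N] [Fintype K] [DecidableEq K]

/-! Fix a unit vector `u` and put `a = I^{-1/2} u`. Then `uᵀ W^S` is the derivative of the
log-likelihood in the direction `a`. Mean and covariance are linear in the parameter, so with `S =
Σ(ψ)`, `H = Σ(a)` and a standard normal vector `w` this derivative is a centred quadratic polynomial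
`b·w + wᵀ A w - tr A` of variance 1, where `A = S^{-1/2} H S^{-1/2} / 2` (`inner_score`,
`exists_scoreForm_sqrt_eq`, `exists_inner_stdScore_eq`). In an eigenbasis of `A` its characteristic
function is an explicit product, and the exponent differs from `-t²/2` by at most `2|t|³δ` if all
eigenvalues of `A` are at most `δ` in absolute value (`norm_cumulant_sub_le`,
`exists_charFun_quadratic_stdGaussian_eq`). The limit theorem thus reduces to showing that a
direction of bounded information has small eigenvalues relative to `S`.

This is `Sig_direction_bound`: if `-sS ≤ H ≤ sS` with the `s` found there, then `m s² ≤ C F`, where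
`F = tr(S⁻¹HS⁻¹H)`. The orthogonal complement of the column space of `Z` has dimension at least `(c₁
- 1) m q`, which controls the error-variance part of `a`. On the column space, after the Gram
matrices are replaced by multiples of the identity, the same `q × q` matrix appears in all `m`
blocks, so one block carries only a fraction of order `1/m` of the information; its operator norm is
at most its Frobenius norm. Everything is measured relative to `S`, so the constant does not depend
on `ψ`.

For the restricted model, compression by `V` lowers `F` by at most `2 p s²`, hence by at most `2 C
(p/m) F` (`infoForm_compression_ge`). When `p/m → 0`, at least half of the information eventually
remains, so the restricted information is positive definite. The bound `-sS ≤ H ≤ sS` passes to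
compressions, and the same argument applies. -/

lemma exists_eq_transpose_mul_self {A : Matrix N N ℝ} (hA : A.PosSemidef) :
    ∃ C : Matrix N N ℝ, A = Cᵀ * C := by
  obtain ⟨C, hC⟩ := CStarAlgebra.nonneg_iff_eq_star_mul_self.mp hA.nonneg
  exact ⟨C, by rw [hC, star_eq_conjTranspose, conjTranspose_eq_transpose_of_trivial]⟩

lemma posSemidef_real_iff {A : Matrix N N ℝ} :
    A.PosSemidef ↔ Aᵀ = A ∧ ∀ x : N → ℝ, 0 ≤ x ⬝ᵥ (A *ᵥ x) := by
  rw [posSemidef_iff_dotProduct_mulVec, Matrix.IsHermitian, conjTranspose_eq_transpose_of_trivial]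
  simp

lemma posDef_real_iff {A : Matrix N N ℝ} :
    A.PosDef ↔ Aᵀ = A ∧ ∀ x : N → ℝ, x ≠ 0 → 0 < x ⬝ᵥ (A *ᵥ x) := by
  rw [posDef_iff_dotProduct_mulVec, Matrix.IsHermitian, conjTranspose_eq_transpose_of_trivial]
  simp

lemma posSemidef_transpose_mul_mul {A : Matrix N N ℝ} (hA : A.PosSemidef) (B : Matrix N K ℝ) :
    (Bᵀ * A * B).PosSemidef := by
  rw [← conjTranspose_eq_transpose_of_trivial]; exact hA.conjTranspose_mul_mul_same B

lemma posSemidef_mul_mul_transpose {A : Matrix N N ℝ} (hA : A.PosSemidef) (B : Matrix K N ℝ) :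
    (B * A * Bᵀ).PosSemidef := by
  rw [← conjTranspose_eq_transpose_of_trivial]; exact hA.mul_mul_conjTranspose_same B

lemma transpose_eq_of_posSemidef {A : Matrix N N ℝ} (hA : A.PosSemidef) : Aᵀ = A :=
  (posSemidef_real_iff.1 hA).1

lemma trace_mul_nonneg {A B : Matrix N N ℝ} (hA : A.PosSemidef) (hB : B.PosSemidef) :
    0 ≤ (A * B).trace := by
  obtain ⟨C, rfl⟩ := exists_eq_transpose_mul_self hA
  rw [Matrix.mul_assoc, trace_mul_comm]
  exact (posSemidef_mul_mul_transpose hB C).trace_nonneg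

lemma dotProduct_transpose_mul_mul (A : Matrix N N ℝ) (B : Matrix N K ℝ) (x : K → ℝ) :
    x ⬝ᵥ ((Bᵀ * A * B) *ᵥ x) = (B *ᵥ x) ⬝ᵥ (A *ᵥ (B *ᵥ x)) := by
  rw [← mulVec_mulVec, ← mulVec_mulVec, dotProduct_mulVec, vecMul_transpose]

/-- Cauchy–Schwarz for `K` and `y yᵀ` in the Frobenius inner product; this is how an operator norm
is bounded by a Frobenius norm. -/
lemma sq_dotProduct_mulVec_le (K : Matrix N N ℝ) (y : N → ℝ) :
    (y ⬝ᵥ (K *ᵥ y)) ^ 2 ≤ (K * Kᵀ).trace * (y ⬝ᵥ y) ^ 2 := by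
  have h1 : y ⬝ᵥ (K *ᵥ y) = ∑ ij : N × N, K ij.1 ij.2 * (y ij.1 * y ij.2) := by
    rw [Fintype.sum_prod_type]
    simp only [dotProduct, mulVec, Finset.mul_sum]
    exact Finset.sum_congr rfl fun i _ => Finset.sum_congr rfl fun j _ => by ring
  have h2 : (K * Kᵀ).trace = ∑ ij : N × N, K ij.1 ij.2 ^ 2 := by
    rw [Fintype.sum_prod_type]
    simp only [Matrix.trace, diag_apply, Matrix.mul_apply, transpose_apply, sq]
  have h3 : (y ⬝ᵥ y) ^ 2 = ∑ ij : N × N, (y ij.1 * y ij.2) ^ 2 := by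
    rw [Fintype.sum_prod_type]
    simp only [dotProduct, sq, Finset.sum_mul_sum]
    exact Finset.sum_congr rfl fun i _ => Finset.sum_congr rfl fun j _ => by ring
  rw [h1, h2, h3]
  exact Finset.sum_mul_sq_le_sq_mul_sq _ _ _

/-- The inverse is antitone on positive definite matrices. -/
lemma posSemidef_inv_sub_inv {T T' : Matrix N N ℝ} (hT : T.PosDef) (hT' : T'.PosDef)
    (h : (T' - T).PosSemidef) : (T⁻¹ - T'⁻¹).PosSemidef := by
  have u : T⁻¹ * T = 1 := nonsing_inv_mul _ ((isUnit_iff_isUnit_det _).1 hT.isUnit)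
  have u2 : T * T⁻¹ = 1 := mul_nonsing_inv _ ((isUnit_iff_isUnit_det _).1 hT.isUnit)
  have u' : T'⁻¹ * T' = 1 := nonsing_inv_mul _ ((isUnit_iff_isUnit_det _).1 hT'.isUnit)
  have u2' : T' * T'⁻¹ = 1 := mul_nonsing_inv _ ((isUnit_iff_isUnit_det _).1 hT'.isUnit)
  -- With `Δ = T' - T`, the difference of inverses is a congruence of `Δ` plus a congruence of
  -- `T⁻¹`, both positive semidefinite.
  have e : T⁻¹ - T'⁻¹ = T'⁻¹ * (T' - T) * T'⁻¹ + (T'⁻¹ * (T' - T)) * T⁻¹ * ((T' - T) * T'⁻¹) := by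
    have e1 : T'⁻¹ * (T' - T) = 1 - T'⁻¹ * T := by rw [Matrix.mul_sub, u']
    have e2 : (T' - T) * T'⁻¹ = 1 - T * T'⁻¹ := by rw [Matrix.sub_mul, u2']
    have e3 : T'⁻¹ * T * T⁻¹ = T'⁻¹ := by rw [Matrix.mul_assoc, u2, Matrix.mul_one]
    have e4 : T⁻¹ * (T * T'⁻¹) = T'⁻¹ := by rw [← Matrix.mul_assoc, u, Matrix.one_mul]
    rw [e1, e2]
    simp only [Matrix.sub_mul, Matrix.mul_sub, Matrix.one_mul, Matrix.mul_one, e3, e4,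
      Matrix.mul_assoc T'⁻¹ T T'⁻¹]
    abel
  rw [e]
  have s1 : ((T' - T) * T'⁻¹) = (T'⁻¹ * (T' - T))ᵀ := by
    rw [transpose_mul, transpose_eq_of_posSemidef h, transpose_eq_of_posSemidef hT'.posSemidef.inv]
  refine Matrix.PosSemidef.add ?_ ?_
  · have := posSemidef_mul_mul_transpose h T'⁻¹
    rwa [transpose_eq_of_posSemidef hT'.posSemidef.inv] at this
  · rw [s1]; exact posSemidef_mul_mul_transpose hT.posSemidef.inv _

/-- Twice the Fisher information of the family `N(0, S)` in the direction `H`. -/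
def infoForm (S H : Matrix N N ℝ) : ℝ := (S⁻¹ * H * (S⁻¹ * H)).trace

/-- With `S⁻¹ = Cᵀ C`, the information form is the squared Frobenius norm of `C H Cᵀ`. -/
lemma exists_infoForm_eq {S : Matrix N N ℝ} (hS : S.PosDef) :
    ∃ C : Matrix N N ℝ, IsUnit C.det ∧ S⁻¹ = Cᵀ * C ∧
      ∀ H : Matrix N N ℝ, Hᵀ = H → infoForm S H = ((C * H * Cᵀ) * (C * H * Cᵀ)ᵀ).trace := by
  obtain ⟨C, hC⟩ := exists_eq_transpose_mul_self hS.posSemidef.inv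
  refine ⟨C, ?_, hC, fun H hH => ?_⟩
  · have h : IsUnit (S⁻¹).det := (isUnit_iff_isUnit_det _).1 hS.inv.isUnit
    rw [hC, det_mul] at h
    exact isUnit_of_mul_isUnit_right h
  · rw [infoForm, hC]
    simp only [transpose_mul, transpose_transpose, hH]
    rw [← trace_mul_comm]
    simp only [Matrix.mul_assoc]
    rw [trace_mul_comm]
    simp only [Matrix.mul_assoc]

lemma trace_mul_transpose_nonneg (A : Matrix N N ℝ) : 0 ≤ (A * Aᵀ).trace := by
  rw [← conjTranspose_eq_transpose_of_trivial]
  exact (posSemidef_self_mul_conjTranspose A).trace_nonneg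

lemma infoForm_nonneg {S H : Matrix N N ℝ} (hS : S.PosDef) (hH : Hᵀ = H) : 0 ≤ infoForm S H := by
  obtain ⟨C, -, -, h⟩ := exists_infoForm_eq hS
  rw [h H hH]; exact trace_mul_transpose_nonneg _

lemma eq_zero_of_infoForm_eq_zero {S H : Matrix N N ℝ} (hS : S.PosDef) (hH : Hᵀ = H)
    (h0 : infoForm S H = 0) : H = 0 := by
  obtain ⟨C, hu, -, h⟩ := exists_infoForm_eq hS
  rw [h H hH, ← conjTranspose_eq_transpose_of_trivial (C * H * Cᵀ),
    trace_mul_conjTranspose_self_eq_zero_iff] at h0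
  have hu' : IsUnit (Cᵀ).det := by rwa [det_transpose]
  calc H = C⁻¹ * (C * H * Cᵀ) * (Cᵀ)⁻¹ := by
        rw [Matrix.mul_assoc C, nonsing_inv_mul_cancel_left _ _ hu,
          mul_nonsing_inv_cancel_right _ _ hu']
    _ = 0 := by simp [h0]

/-- A symmetric matrix is dominated, as a quadratic form, by its information norm. -/
lemma abs_dotProduct_mulVec_le_infoForm {S H : Matrix N N ℝ} (hS : S.PosDef) (hH : Hᵀ = H)
    (x : N → ℝ) : |x ⬝ᵥ (H *ᵥ x)| ≤ √(infoForm S H) * (x ⬝ᵥ (S *ᵥ x)) := by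
  obtain ⟨C, hu, hC, h⟩ := exists_infoForm_eq hS
  have hu' : IsUnit (Cᵀ).det := by rwa [det_transpose]
  -- Substituting `z = (Cᵀ)⁻¹ x` turns `S` into the identity and `H` into `C H Cᵀ`.
  have hx : (x ⬝ᵥ (S *ᵥ x)) = ((Cᵀ)⁻¹ *ᵥ x) ⬝ᵥ ((Cᵀ)⁻¹ *ᵥ x) := by
    have hSe : S = C⁻¹ * (Cᵀ)⁻¹ := by
      rw [← Matrix.mul_inv_rev, ← hC, nonsing_inv_nonsing_inv _
        ((isUnit_iff_isUnit_det _).1 hS.isUnit)]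
    rw [dotProduct_mulVec ((Cᵀ)⁻¹ *ᵥ x), ← mulVec_transpose, mulVec_mulVec, transpose_nonsing_inv,
      transpose_transpose, ← hSe, dotProduct_comm]
  have hHx : x ⬝ᵥ (H *ᵥ x) = ((Cᵀ)⁻¹ *ᵥ x) ⬝ᵥ ((C * H * Cᵀ) *ᵥ ((Cᵀ)⁻¹ *ᵥ x)) := by
    rw [← dotProduct_transpose_mul_mul, transpose_nonsing_inv, transpose_transpose,
      Matrix.mul_assoc C, nonsing_inv_mul_cancel_left _ _ hu,
          mul_nonsing_inv_cancel_right _ _ hu']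
  have := sq_dotProduct_mulVec_le (C * H * Cᵀ) ((Cᵀ)⁻¹ *ᵥ x)
  rw [← hHx, ← hx, ← h H hH] at this
  apply abs_le_of_sq_le_sq
  · rw [mul_pow, Real.sq_sqrt (infoForm_nonneg hS hH)]; exact this
  · have := (posSemidef_real_iff.1 hS.posSemidef).2 x
    positivity

/-- Replace one inverse at a time: the mixed trace `tr(T'⁻¹ M T⁻¹ M)` lies between the two forms. -/
lemma infoForm_anti {T T' M : Matrix N N ℝ} (hT : T.PosDef) (hT' : T'.PosDef)
    (h : (T' - T).PosSemidef) (hM : Mᵀ = M) : infoForm T' M ≤ infoForm T M := by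
  have hd := posSemidef_inv_sub_inv hT hT' h
  have p1 : (M * T⁻¹ * M).PosSemidef := by
    simpa [hM] using posSemidef_transpose_mul_mul hT.posSemidef.inv M
  have p2 : (M * T'⁻¹ * M).PosSemidef := by
    simpa [hM] using posSemidef_transpose_mul_mul hT'.posSemidef.inv M
  have t1 := trace_mul_nonneg hd p1
  have t2 := trace_mul_nonneg hd p2
  have e1 : ((T⁻¹ - T'⁻¹) * (M * T⁻¹ * M)).trace = infoForm T M - (T'⁻¹ * M * (T⁻¹ * M)).trace := by
    rw [Matrix.sub_mul, trace_sub, infoForm]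
    simp only [Matrix.mul_assoc]
  have e2 : ((T⁻¹ - T'⁻¹) * (M * T'⁻¹ * M)).trace =
      (T'⁻¹ * M * (T⁻¹ * M)).trace - infoForm T' M := by
    rw [Matrix.sub_mul, trace_sub, infoForm, trace_mul_comm (T'⁻¹ * M)]
    simp only [Matrix.mul_assoc]
  linarith

/-- Parallelogram law for a nonnegative quadratic form. -/
lemma infoForm_add_le {S A B : Matrix N N ℝ} (hS : S.PosDef) (hA : Aᵀ = A) (hB : Bᵀ = B) :
    infoForm S (A + B) ≤ 2 * infoForm S A + 2 * infoForm S B := by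
  have h := infoForm_nonneg (H := A - B) hS (by rw [transpose_sub, hA, hB])
  have : infoForm S (A + B) + infoForm S (A - B) = 2 * infoForm S A + 2 * infoForm S B := by
    simp only [infoForm, Matrix.mul_add, Matrix.mul_sub, Matrix.add_mul, Matrix.sub_mul,
      trace_add, trace_sub]
    ring
  linarith

lemma infoForm_smul (S A : Matrix N N ℝ) (a : ℝ) : infoForm S (a • A) = a ^ 2 * infoForm S A := by
  simp only [infoForm, Matrix.mul_smul, Matrix.smul_mul, smul_smul, trace_smul, smul_eq_mul]
  ring

lemma infoForm_smul_self {B : Matrix N N ℝ} (hB : B.PosDef) {r : ℝ} (hr : 0 < r) :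
    infoForm (r • B) B = Fintype.card N / r ^ 2 := by
  have hu : IsUnit B.det := (isUnit_iff_isUnit_det _).1 hB.isUnit
  have h1 : (r • B)⁻¹ = r⁻¹ • B⁻¹ := by
    apply inv_eq_left_inv
    rw [Matrix.smul_mul, Matrix.mul_smul, smul_smul, nonsing_inv_mul _ hu, inv_mul_cancel₀ hr.ne',
      one_smul]
  rw [infoForm, h1, Matrix.smul_mul, nonsing_inv_mul _ hu]
  simp [trace_smul, field]

end MatrixFacts

/-! ### Covariances of the form `Z Ψ Zᵀ + r I` -/

section RandomEffectCovariance

variable {N K : Type*} [Fintype N] [DecidableEq N] [Fintype K] [DecidableEq K]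

/-- The information form of `Z Ψ Zᵀ + r I` splits into the column space of `Z` and its
orthogonal complement. -/
lemma infoForm_mul_mul_transpose_add {Z : Matrix N K ℝ} (hG : (Zᵀ * Z).PosDef)
    {Ψ : Matrix K K ℝ} (hΨ : Ψ.PosSemidef) (M : Matrix K K ℝ) {r : ℝ} (hr : 0 < r) (a : ℝ) :
    infoForm (Z * Ψ * Zᵀ + r • 1) (Z * M * Zᵀ + a • 1) =
      infoForm (Ψ + r • (Zᵀ * Z)⁻¹) (M + a • (Zᵀ * Z)⁻¹) +
        ((Fintype.card N : ℝ) - Fintype.card K) * (a / r) ^ 2 := by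
  set G := Zᵀ * Z with hGdef
  have hGu : IsUnit G.det := (isUnit_iff_isUnit_det _).1 hG.isUnit
  set T := Ψ + r • G⁻¹ with hT
  have hTpd : T.PosDef := PosDef.posSemidef_add hΨ (hG.inv.smul hr)
  have hTu : IsUnit T.det := (isUnit_iff_isUnit_det _).1 hTpd.isUnit
  clear_value T
  -- `W` is dual to `Z`; `Z Wᵀ` is the orthogonal projection onto the column space of `Z`, and `R`
  -- below is the complementary projection.
  set W := Z * G⁻¹ with hW
  have hGs : Gᵀ = G := transpose_eq_of_posSemidef hG.posSemidef
  have hWt : Wᵀ = G⁻¹ * Zᵀ := by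
    rw [hW, transpose_mul, transpose_nonsing_inv, hGs]
  have hWZ : Wᵀ * Z = 1 := by rw [hWt, Matrix.mul_assoc, ← hGdef, nonsing_inv_mul _ hGu]
  have hZW : Zᵀ * W = 1 := by rw [hW, ← Matrix.mul_assoc, ← hGdef, mul_nonsing_inv _ hGu]
  set R : Matrix N N ℝ := 1 - Z * Wᵀ with hR
  have hRZ : R * Z = 0 := by
    rw [hR, Matrix.sub_mul, Matrix.mul_assoc, hWZ]; simp
  have hWR : Wᵀ * R = 0 := by
    rw [hR, Matrix.mul_sub, ← Matrix.mul_assoc, hWZ]; simp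
  have hZW' : Z * Wᵀ = W * Zᵀ := by rw [hWt, hW, Matrix.mul_assoc]
  have hZR : Zᵀ * R = 0 := by
    rw [hR, hZW', Matrix.mul_sub, ← Matrix.mul_assoc, hZW]; simp
  have hRW : R * W = 0 := by
    rw [hR, hZW', Matrix.sub_mul, Matrix.mul_assoc, hZW]; simp
  have hRR : R * R = R := by
    nth_rewrite 2 [hR]
    rw [Matrix.mul_sub, ← Matrix.mul_assoc, hRZ]; simp
  -- Since `I = Z G⁻¹ Zᵀ + R`, the scalar part is absorbed into the middle factor; products and
  -- inverses are then computed separately on the two orthogonal pieces.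
  have hform (A : Matrix K K ℝ) (b : ℝ) :
      Z * A * Zᵀ + b • 1 = Z * (A + b • G⁻¹) * Zᵀ + b • R := by
    have : Z * (b • G⁻¹) * Zᵀ = b • (Z * Wᵀ) := by
      rw [hWt]; simp only [Matrix.mul_smul, Matrix.smul_mul, Matrix.mul_assoc]
    rw [Matrix.mul_add, Matrix.add_mul, this, hR, smul_sub]
    abel
  have hinv : (Z * Ψ * Zᵀ + r • 1)⁻¹ = W * T⁻¹ * Wᵀ + r⁻¹ • R := by
    apply inv_eq_left_inv
    rw [hform, ← hT, Matrix.add_mul, Matrix.mul_add, Matrix.mul_add]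
    have e1 : W * T⁻¹ * Wᵀ * (Z * T * Zᵀ) = W * Zᵀ := by
      calc _ = W * T⁻¹ * (Wᵀ * Z) * T * Zᵀ := by simp only [Matrix.mul_assoc]
        _ = _ := by rw [hWZ, Matrix.mul_one, nonsing_inv_mul_cancel_right _ _ hTu]
    have e2 : W * T⁻¹ * Wᵀ * (r • R) = 0 := by
      rw [Matrix.mul_smul, Matrix.mul_assoc _ Wᵀ, hWR]; simp
    have e3 : r⁻¹ • R * (Z * T * Zᵀ) = 0 := by
      rw [Matrix.smul_mul, Matrix.mul_assoc Z, ← Matrix.mul_assoc R, hRZ]; simp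
    have e4 : r⁻¹ • R * (r • R) = R := by
      rw [Matrix.smul_mul, Matrix.mul_smul, smul_smul, hRR, inv_mul_cancel₀ hr.ne', one_smul]
    rw [e1, e2, e3, e4, ← hZW', hR]; abel
  set M' := M + a • G⁻¹ with hM'
  clear_value M'
  have hprod : (Z * Ψ * Zᵀ + r • 1)⁻¹ * (Z * M * Zᵀ + a • 1) =
      W * (T⁻¹ * M') * Zᵀ + (a / r) • R := by
    rw [hinv, hform M a, ← hM', Matrix.add_mul, Matrix.mul_add, Matrix.mul_add]
    have e1 : W * T⁻¹ * Wᵀ * (Z * M' * Zᵀ) = W * (T⁻¹ * M') * Zᵀ := by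
      calc _ = W * T⁻¹ * (Wᵀ * Z) * M' * Zᵀ := by simp only [Matrix.mul_assoc]
        _ = _ := by rw [hWZ, Matrix.mul_one, Matrix.mul_assoc W]
    have e2 : W * T⁻¹ * Wᵀ * (a • R) = 0 := by
      rw [Matrix.mul_smul, Matrix.mul_assoc _ Wᵀ, hWR]; simp
    have e3 : r⁻¹ • R * (Z * M' * Zᵀ) = 0 := by
      rw [Matrix.smul_mul, Matrix.mul_assoc Z, ← Matrix.mul_assoc R, hRZ]; simp
    have e4 : r⁻¹ • R * (a • R) = (a / r) • R := by
      rw [Matrix.smul_mul, Matrix.mul_smul, smul_smul, hRR, div_eq_inv_mul]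
    rw [e1, e2, e3, e4]; abel
  rw [infoForm, infoForm, hprod, Matrix.add_mul, Matrix.mul_add, Matrix.mul_add]
  have e1 : W * (T⁻¹ * M') * Zᵀ * (W * (T⁻¹ * M') * Zᵀ) = W * (T⁻¹ * M' * (T⁻¹ * M')) * Zᵀ := by
    calc _ = W * (T⁻¹ * M') * (Zᵀ * W) * (T⁻¹ * M') * Zᵀ := by simp only [Matrix.mul_assoc]
      _ = _ := by rw [hZW, Matrix.mul_one, Matrix.mul_assoc W]
  have e2 : W * (T⁻¹ * M') * Zᵀ * ((a / r) • R) = 0 := by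
    rw [Matrix.mul_smul, Matrix.mul_assoc _ Zᵀ, hZR]; simp
  have e3 : (a / r) • R * (W * (T⁻¹ * M') * Zᵀ) = 0 := by
    rw [Matrix.smul_mul, Matrix.mul_assoc W, ← Matrix.mul_assoc R, hRW]; simp
  have e4 : (a / r) • R * ((a / r) • R) = (a / r) ^ 2 • R := by
    rw [Matrix.smul_mul, Matrix.mul_smul, smul_smul, hRR, sq]
  have tr1 : (W * (T⁻¹ * M' * (T⁻¹ * M')) * Zᵀ).trace = (T⁻¹ * M' * (T⁻¹ * M')).trace := by
    rw [Matrix.mul_assoc, trace_mul_comm, Matrix.mul_assoc, hZW, Matrix.mul_one]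
  have tr2 : R.trace = (Fintype.card N : ℝ) - Fintype.card K := by
    rw [hR, trace_sub, trace_mul_comm, hWZ, trace_one, trace_one]
  rw [e1, e2, e3, e4, add_zero, zero_add, trace_add, tr1, trace_smul, tr2, smul_eq_mul]
  ring

/-- Lower bounds for the information form of `Z Ψ Zᵀ + r I`. -/
lemma infoForm_lower_bounds {Z : Matrix N K ℝ} (hG : (Zᵀ * Z).PosDef) {c : ℝ} (hc : 0 < c)
    (hGc : (Zᵀ * Z - c⁻¹ • 1).PosSemidef)
    {Ψ : Matrix K K ℝ} (hΨ : Ψ.PosSemidef) {M : Matrix K K ℝ} (hM : Mᵀ = M)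
    {r : ℝ} (hr : 0 < r) (a : ℝ) :
    ((Fintype.card N : ℝ) - Fintype.card K) * (a / r) ^ 2 ≤
        infoForm (Z * Ψ * Zᵀ + r • 1) (Z * M * Zᵀ + a • 1) ∧
      infoForm (Ψ + (c * r) • 1) M ≤
        2 * (infoForm (Z * Ψ * Zᵀ + r • 1) (Z * M * Zᵀ + a • 1) -
          ((Fintype.card N : ℝ) - Fintype.card K) * (a / r) ^ 2) +
        2 * Fintype.card K * (a / r) ^ 2 := by
  rw [infoForm_mul_mul_transpose_add hG hΨ M hr a]
  set G := Zᵀ * Z with hGdef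
  have hGs : Gᵀ = G := transpose_eq_of_posSemidef hG.posSemidef
  have hGi : (G⁻¹)ᵀ = G⁻¹ := by rw [transpose_nonsing_inv, hGs]
  have hTpd : (Ψ + r • G⁻¹).PosDef := PosDef.posSemidef_add hΨ (hG.inv.smul hr)
  have hM' : (M + a • G⁻¹)ᵀ = M + a • G⁻¹ := by rw [transpose_add, transpose_smul, hGi, hM]
  have h1 := infoForm_nonneg hTpd hM'
  refine ⟨by linarith, ?_⟩
  have hIpd : ((c * r) • (1 : Matrix K K ℝ)).PosDef := PosDef.one.smul (by positivity)
  have hc1 : (c⁻¹ • (1 : Matrix K K ℝ)).PosDef := PosDef.one.smul (by positivity)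
  have hinv : (c • (1 : Matrix K K ℝ) - G⁻¹).PosSemidef := by
    have := posSemidef_inv_sub_inv hc1 hG hGc
    have e : (c⁻¹ • (1 : Matrix K K ℝ))⁻¹ = c • 1 := by
      apply inv_eq_left_inv
      rw [Matrix.smul_mul, Matrix.mul_smul, smul_smul, mul_inv_cancel₀ hc.ne']; simp
    rwa [e] at this
  -- As `G⁻¹ ≤ c I`, enlarging `r G⁻¹` to `c r I` only lowers the form, and it removes the
  -- dependence on the Gram matrix.
  have h2 : infoForm (Ψ + (c * r) • 1) M ≤ infoForm (Ψ + r • G⁻¹) M := by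
    refine infoForm_anti hTpd (PosDef.posSemidef_add hΨ hIpd) ?_ hM
    have : Ψ + (c * r) • (1 : Matrix K K ℝ) - (Ψ + r • G⁻¹) = r • (c • 1 - G⁻¹) := by
      rw [smul_sub, smul_smul, mul_comm r c]; abel
    rw [this]; exact hinv.smul hr.le
  have h3 : infoForm (Ψ + r • G⁻¹) M ≤ 2 * infoForm (Ψ + r • G⁻¹) (M + a • G⁻¹) +
      2 * infoForm (Ψ + r • G⁻¹) ((-a) • G⁻¹) := by
    have := infoForm_add_le (A := M + a • G⁻¹) (B := (-a) • G⁻¹) hTpd hM'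
      (by rw [transpose_smul, hGi])
    rwa [neg_smul, add_neg_cancel_right, ← neg_smul] at this
  -- Dropping `Ψ` can only raise the form, and without it the value is explicit.
  have h4 : infoForm (Ψ + r • G⁻¹) ((-a) • G⁻¹) ≤ Fintype.card K * (a / r) ^ 2 := by
    rw [infoForm_smul]
    have : infoForm (Ψ + r • G⁻¹) G⁻¹ ≤ infoForm (r • G⁻¹) G⁻¹ :=
      infoForm_anti (hG.inv.smul hr) hTpd (by simpa using hΨ) hGi
    rw [infoForm_smul_self hG.inv hr] at this
    calc (-a) ^ 2 * infoForm (Ψ + r • G⁻¹) G⁻¹ ≤ (-a) ^ 2 * (Fintype.card K / r ^ 2) :=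
          mul_le_mul_of_nonneg_left this (sq_nonneg _)
      _ = _ := by rw [neg_sq, div_pow]; ring
  linarith

/-- Upper bound for `Z M Zᵀ + a I` in terms of `Z Ψ Zᵀ + r I`, as quadratic forms. -/
lemma abs_dotProduct_mulVec_mul_mul_transpose_add_le {Z : Matrix N K ℝ} {c : ℝ} (hc : 1 ≤ c)
    (hZc : (c • 1 - Z * Zᵀ).PosSemidef)
    {Ψ : Matrix K K ℝ} (hΨ : Ψ.PosSemidef) {M : Matrix K K ℝ} {k : ℝ} (hk : 0 ≤ k)
    {r : ℝ} (hr : 0 < r) (a : ℝ)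
    (hM : ∀ y, |y ⬝ᵥ (M *ᵥ y)| ≤ k * (y ⬝ᵥ ((Ψ + (c * r) • 1) *ᵥ y))) (x : N → ℝ) :
    |x ⬝ᵥ ((Z * M * Zᵀ + a • 1) *ᵥ x)| ≤
      (c ^ 2 * k + |a| / r) * (x ⬝ᵥ ((Z * Ψ * Zᵀ + r • 1) *ᵥ x)) := by
  have key (A : Matrix K K ℝ) (b : ℝ) : x ⬝ᵥ ((Z * A * Zᵀ + b • 1) *ᵥ x) =
      (Zᵀ *ᵥ x) ⬝ᵥ (A *ᵥ (Zᵀ *ᵥ x)) + b * (x ⬝ᵥ x) := by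
    have := dotProduct_transpose_mul_mul A Zᵀ x
    rw [transpose_transpose] at this
    rw [add_mulVec, dotProduct_add, this, smul_mulVec, one_mulVec, dotProduct_smul, smul_eq_mul]
  have h1 : (Zᵀ *ᵥ x) ⬝ᵥ (Zᵀ *ᵥ x) ≤ c * (x ⬝ᵥ x) := by
    have := (posSemidef_real_iff.1 hZc).2 x
    rw [sub_mulVec, dotProduct_sub, smul_mulVec, one_mulVec, dotProduct_smul, smul_eq_mul,
      ← mulVec_mulVec, dotProduct_mulVec, ← mulVec_transpose] at this
    linarith
  have h2 := hM (Zᵀ *ᵥ x)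
  have h3 := (posSemidef_real_iff.1 hΨ).2 (Zᵀ *ᵥ x)
  have h0 : 0 ≤ x ⬝ᵥ x := by
    simpa using dotProduct_self_star_nonneg x
  rw [add_mulVec, dotProduct_add, smul_mulVec, one_mulVec, dotProduct_smul, smul_eq_mul] at h2
  rw [key, key]
  set P := (Zᵀ *ᵥ x) ⬝ᵥ (Ψ *ᵥ (Zᵀ *ᵥ x))
  set Q := (Zᵀ *ᵥ x) ⬝ᵥ (M *ᵥ (Zᵀ *ᵥ x))
  set E := (Zᵀ *ᵥ x) ⬝ᵥ (Zᵀ *ᵥ x)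
  set D := x ⬝ᵥ x
  -- One factor `c` is already in `c r`, the other comes from `E ≤ c D`; `P` is enlarged using `c ≥
  -- 1`.
  have h4 : P + c * r * E ≤ c ^ 2 * (P + r * D) := by
    have i1 : c * r * E ≤ c * r * (c * D) := mul_le_mul_of_nonneg_left h1 (by positivity)
    have i2 : P ≤ c ^ 2 * P := le_mul_of_one_le_left h3 (one_le_pow₀ hc)
    nlinarith
  have h5 : |a * D| ≤ |a| / r * (P + r * D) := by
    rw [abs_mul, abs_of_nonneg h0]
    have : |a| * D = |a| / r * (r * D) := by field_simp
    rw [this]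
    exact mul_le_mul_of_nonneg_left (by linarith) (by positivity)
  calc |Q + a * D| ≤ |Q| + |a * D| := abs_add_le _ _
    _ ≤ k * (c ^ 2 * (P + r * D)) + |a| / r * (P + r * D) :=
        add_le_add (h2.trans (mul_le_mul_of_nonneg_left h4 hk)) h5
    _ = _ := by ring

end RandomEffectCovariance

/-! ### Block-diagonal matrices -/

section BlockDiagonal

variable {m q : ℕ} {n : Fin m → ℕ}

lemma dotProduct_blockDiagonal'_mulVec (A : (i : Fin m) → Matrix (Fin (n i)) (Fin (n i)) ℝ)
    (x : ((i : Fin m) × Fin (n i)) → ℝ) :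
    x ⬝ᵥ (blockDiagonal' A *ᵥ x) = ∑ i, (fun j => x ⟨i, j⟩) ⬝ᵥ (A i *ᵥ fun j => x ⟨i, j⟩) := by
  simp only [dotProduct, mulVec, Fintype.sum_sigma]
  refine Finset.sum_congr rfl fun i _ => Finset.sum_congr rfl fun j _ => ?_
  congr 1
  rw [Finset.sum_eq_single i]
  · simp [blockDiagonal'_apply_eq]
  · intro b _ hb
    exact Finset.sum_eq_zero fun k _ => by rw [blockDiagonal'_apply_ne _ _ _ hb.symm, zero_mul]
  · simp

lemma posSemidef_blockDiagonal' {A : (i : Fin m) → Matrix (Fin (n i)) (Fin (n i)) ℝ}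
    (hA : ∀ i, (A i).PosSemidef) : (blockDiagonal' A).PosSemidef := by
  rw [posSemidef_real_iff]
  refine ⟨?_, fun x => ?_⟩
  · rw [blockDiagonal'_transpose]
    congr 1; funext i; exact transpose_eq_of_posSemidef (hA i)
  · rw [dotProduct_blockDiagonal'_mulVec]
    exact Finset.sum_nonneg fun i _ => (posSemidef_real_iff.1 (hA i)).2 _

/-- Traces add over equal blocks. This factor `m` is the source of the rate `m^{-1/2}`. -/
lemma infoForm_blockDiagonal'_const (D M : Matrix (Fin q) (Fin q) ℝ) (hD : IsUnit D.det) :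
    infoForm (blockDiagonal' fun _ : Fin m => D) (blockDiagonal' fun _ : Fin m => M) =
      m * infoForm D M := by
  have : (blockDiagonal' fun _ : Fin m => D)⁻¹ = blockDiagonal' fun _ : Fin m => D⁻¹ := by
    apply inv_eq_left_inv
    rw [← blockDiagonal'_mul]
    simp_rw [nonsing_inv_mul _ hD]
    exact blockDiagonal'_one
  rw [infoForm, this, ← blockDiagonal'_mul, ← blockDiagonal'_mul, trace_blockDiagonal', infoForm]
  simp

end BlockDiagonal

/-! ### Loss of information under compression to a subspace -/

section Compression

variable {N K : Type*} [Fintype N] [DecidableEq N] [Fintype K] [DecidableEq K]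

lemma posDef_transpose_mul_mul {S : Matrix N N ℝ} (hS : S.PosDef) {V : Matrix N K ℝ}
    (hV : Vᵀ * V = 1) : (Vᵀ * S * V).PosDef := by
  rw [← conjTranspose_eq_transpose_of_trivial]
  refine hS.conjTranspose_mul_mul_same fun x y h => ?_
  have := congrArg (Vᵀ *ᵥ ·) h
  simpa [mulVec_mulVec, hV] using this

/-- If `-s S ≤ H ≤ s S`, then `H S⁻¹ H ≤ s² S`. -/
lemma posSemidef_sq_smul_sub_mul_inv_mul {S H : Matrix N N ℝ} (hS : S.PosDef) (hH : Hᵀ = H)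
    {s : ℝ} (hs : 0 < s) (h : ∀ x, |x ⬝ᵥ (H *ᵥ x)| ≤ s * (x ⬝ᵥ (S *ᵥ x))) :
    (s ^ 2 • S - H * S⁻¹ * H).PosSemidef := by
  have hu : IsUnit S.det := (isUnit_iff_isUnit_det _).1 hS.isUnit
  have hSs := transpose_eq_of_posSemidef hS.posSemidef
  have hSi := transpose_eq_of_posSemidef hS.inv.posSemidef
  have h1 : (s • S - H).PosSemidef := by
    rw [posSemidef_real_iff]
    refine ⟨by rw [transpose_sub, transpose_smul, hSs, hH], fun x => ?_⟩
    have := (abs_le.1 (h x)).2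
    rw [sub_mulVec, dotProduct_sub, smul_mulVec, dotProduct_smul, smul_eq_mul]; linarith
  have h2 : (s • S + H).PosSemidef := by
    rw [posSemidef_real_iff]
    refine ⟨by rw [transpose_add, transpose_smul, hSs, hH], fun x => ?_⟩
    have := (abs_le.1 (h x)).1
    rw [add_mulVec, dotProduct_add, smul_mulVec, dotProduct_smul, smul_eq_mul]; linarith
  -- Noncommutative form of `(s-x)²(s+x) + (s+x)²(s-x) = 2s(s²-x²)` for `x = S^{-1/2} H S^{-1/2}`;
  -- each summand on the left is a congruence of a positive semidefinite matrix.
  have h3 : ((s • S - H) * S⁻¹ * (s • S + H) * ((s • S - H) * S⁻¹)ᵀ).PosSemidef :=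
    posSemidef_mul_mul_transpose h2 _
  have h4 : ((s • S + H) * S⁻¹ * (s • S - H) * ((s • S + H) * S⁻¹)ᵀ).PosSemidef :=
    posSemidef_mul_mul_transpose h1 _
  have i1 : S * S⁻¹ = 1 := mul_nonsing_inv _ hu
  have i2 : S⁻¹ * S = 1 := nonsing_inv_mul _ hu
  have i4 (A : Matrix N N ℝ) : S * (S⁻¹ * A) = A := mul_nonsing_inv_cancel_left _ _ hu
  have e : (s • S - H) * S⁻¹ * (s • S + H) * ((s • S - H) * S⁻¹)ᵀ +
      (s • S + H) * S⁻¹ * (s • S - H) * ((s • S + H) * S⁻¹)ᵀ =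
      (2 * s) • (s ^ 2 • S - H * S⁻¹ * H) := by
    simp only [transpose_mul, transpose_sub, transpose_add, transpose_smul, hSs, hH, hSi]
    simp only [Matrix.sub_mul, Matrix.add_mul, Matrix.mul_sub, Matrix.mul_add, Matrix.smul_mul,
      Matrix.mul_smul, Matrix.mul_assoc, i1, i2, i4, smul_sub, smul_add, smul_smul,
      Matrix.mul_one, Matrix.one_mul]
    module
  have h5 := (h3.add h4).smul (α := ℝ) (a := (2 * s)⁻¹) (by positivity)
  rwa [e, smul_smul, inv_mul_cancel₀ (by positivity), one_smul] at h5

/-- Compressing a Gaussian family to a subspace of codimension `p` loses at most `2 p s²` of the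
information form in directions bounded by `s`. -/
lemma infoForm_compression_ge {S H : Matrix N N ℝ} (hS : S.PosDef) (hH : Hᵀ = H)
    {s : ℝ} (hs : 0 < s) (h : ∀ x, |x ⬝ᵥ (H *ᵥ x)| ≤ s * (x ⬝ᵥ (S *ᵥ x)))
    {V : Matrix N K ℝ} (hV : Vᵀ * V = 1) :
    infoForm S H - 2 * ((Fintype.card N : ℝ) - Fintype.card K) * s ^ 2 ≤
      infoForm (Vᵀ * S * V) (Vᵀ * H * V) := by
  have hu : IsUnit S.det := (isUnit_iff_isUnit_det _).1 hS.isUnit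
  have hVS := posDef_transpose_mul_mul hS hV
  have hVu : IsUnit (Vᵀ * S * V).det := (isUnit_iff_isUnit_det _).1 hVS.isUnit
  have hSi := transpose_eq_of_posSemidef hS.inv.posSemidef
  set B := (Vᵀ * S * V)⁻¹ with hB
  -- `P` plays the role of the inverse covariance after compression: `P S P = P` gives `P ≤ S⁻¹`,
  -- and `tr((S⁻¹ - P) S)` is the codimension.
  set P := V * B * Vᵀ with hP
  have hPpsd : P.PosSemidef := posSemidef_mul_mul_transpose hVS.inv.posSemidef V
  have hPs := transpose_eq_of_posSemidef hPpsd
  have hPSP : P * S * P = P := by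
    calc P * S * P = V * (B * (Vᵀ * S * V)) * B * Vᵀ := by simp only [hP, Matrix.mul_assoc]
      _ = P := by rw [hB, nonsing_inv_mul _ hVu, Matrix.mul_one, ← hB]
  have hPS : (P * S).trace = Fintype.card K := by
    calc (P * S).trace = (V * (B * Vᵀ * S)).trace := by simp only [hP, Matrix.mul_assoc]
      _ = (B * (Vᵀ * S * V)).trace := by rw [trace_mul_comm]; simp only [Matrix.mul_assoc]
      _ = _ := by rw [hB, nonsing_inv_mul _ hVu, trace_one]
  have hD : (S⁻¹ - P).PosSemidef := by
    have e : (S⁻¹ - P)ᵀ * S * (S⁻¹ - P) = S⁻¹ - P := by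
      rw [transpose_sub, hSi, hPs, Matrix.sub_mul, nonsing_inv_mul _ hu, Matrix.mul_sub,
        Matrix.sub_mul, Matrix.sub_mul, Matrix.one_mul, Matrix.one_mul,
        mul_nonsing_inv_cancel_right _ _ hu, hPSP]
      abel
    rw [← e]; exact posSemidef_transpose_mul_mul hS.posSemidef _
  have hinfo : infoForm (Vᵀ * S * V) (Vᵀ * H * V) = (P * H * (P * H)).trace := by
    rw [infoForm, ← hB]
    calc _ = ((B * Vᵀ * H * V * B * Vᵀ * H) * V).trace := by simp only [Matrix.mul_assoc]
      _ = _ := by rw [trace_mul_comm]; simp only [hP, Matrix.mul_assoc]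
  have q1 : (H * S⁻¹ * H).PosSemidef := by
    simpa [hH] using posSemidef_transpose_mul_mul hS.posSemidef.inv H
  -- With `D = S⁻¹ - P`, the loss is `2 tr(D H S⁻¹ H) - tr(D H D H)`. The second trace is
  -- nonnegative (`q2`), and `H S⁻¹ H ≤ s² S` bounds the first by `s²` times the codimension (`q3`).
  have q2 : 0 ≤ ((S⁻¹ - P) * (H * (S⁻¹ - P) * H)).trace := by
    refine trace_mul_nonneg hD ?_
    simpa [hH] using posSemidef_transpose_mul_mul hD H
  have q3 := trace_mul_nonneg hD (posSemidef_sq_smul_sub_mul_inv_mul hS hH hs h)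
  have e3 : ((S⁻¹ - P) * (s ^ 2 • S - H * S⁻¹ * H)).trace =
      s ^ 2 * ((Fintype.card N : ℝ) - Fintype.card K) - ((S⁻¹ - P) * (H * S⁻¹ * H)).trace := by
    rw [Matrix.mul_sub, trace_sub, Matrix.mul_smul, trace_smul, Matrix.sub_mul, trace_sub,
      nonsing_inv_mul _ hu, trace_one, hPS, smul_eq_mul]
  have e1 : ((S⁻¹ - P) * (H * S⁻¹ * H)).trace = infoForm S H - (P * H * (S⁻¹ * H)).trace := by
    rw [Matrix.sub_mul, trace_sub, infoForm]
    simp only [Matrix.mul_assoc]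
  have e2 : ((S⁻¹ - P) * (H * (S⁻¹ - P) * H)).trace =
      infoForm S H - 2 * (P * H * (S⁻¹ * H)).trace + (P * H * (P * H)).trace := by
    have c : (S⁻¹ * H * (P * H)).trace = (P * H * (S⁻¹ * H)).trace := trace_mul_comm _ _
    simp only [Matrix.sub_mul, Matrix.mul_sub, trace_sub, infoForm, Matrix.mul_assoc] at c ⊢
    rw [c]; ring
  rw [hinfo]
  nlinarith

end Compression

/-! ### Size of a covariance direction against its information -/

section ClusterBounds

lemma posSemidef_sub_smul_of_spectrum {q : ℕ} {A : Matrix (Fin q) (Fin q) ℝ} (hA : Aᵀ = A) {c : ℝ}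
    (h : ∀ γ ∈ spectrum ℝ A, c ≤ γ) : (A - c • 1).PosSemidef := by
  rw [posSemidef_iff_isHermitian_and_spectrum_nonneg]
  constructor
  · rw [Matrix.IsHermitian, conjTranspose_eq_transpose_of_trivial, transpose_sub, hA]; simp
  · intro a ha
    have : a + c ∈ spectrum ℝ A := by
      rw [spectrum.mem_iff] at ha ⊢
      rw [show algebraMap ℝ (Matrix (Fin q) (Fin q) ℝ) (a + c) - A =
        algebraMap ℝ (Matrix (Fin q) (Fin q) ℝ) a - (A - c • 1) by
        rw [map_add, Algebra.algebraMap_eq_smul_one c]; abel]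
      exact ha
    have := h _ this
    simp only [Set.mem_ofPred_eq]; linarith

lemma posSemidef_smul_sub_of_spectrum {q : ℕ} {A : Matrix (Fin q) (Fin q) ℝ} (hA : Aᵀ = A) {c : ℝ}
    (h : ∀ γ ∈ spectrum ℝ A, γ ≤ c) : (c • 1 - A).PosSemidef := by
  have := posSemidef_sub_smul_of_spectrum (A := -A) (c := -c) (by rw [transpose_neg, hA]) (by
    intro γ hγ
    have : -γ ∈ spectrum ℝ A := by rw [← spectrum.neg_eq] at hγ; simpa using hγ
    linarith [h _ this])
  rwa [neg_smul, sub_neg_eq_add, neg_add_eq_sub] at this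

/-- An upper bound for `Zᵀ Z` is an upper bound for `Z Zᵀ`. -/
lemma posSemidef_smul_sub_mul_transpose {N K : Type*} [Fintype N] [DecidableEq N] [Fintype K]
    [DecidableEq K] {Z : Matrix N K ℝ} {c : ℝ} (hc : 0 ≤ c)
    (h : (c • 1 - Zᵀ * Z).PosSemidef) : (c • 1 - Z * Zᵀ).PosSemidef := by
  rw [posSemidef_real_iff] at h ⊢
  refine ⟨by simp [transpose_mul], fun x => ?_⟩
  have h2 := h.2 (Zᵀ *ᵥ x)
  rw [sub_mulVec, dotProduct_sub, smul_mulVec, one_mulVec, dotProduct_smul, smul_eq_mul,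
    ← mulVec_mulVec, dotProduct_mulVec _ Zᵀ (Z *ᵥ (Zᵀ *ᵥ x)),
    vecMul_transpose] at h2
  rw [sub_mulVec, dotProduct_sub, smul_mulVec, one_mulVec, dotProduct_smul, smul_eq_mul,
    ← mulVec_mulVec, dotProduct_mulVec, ← mulVec_transpose]
  set w := Zᵀ *ᵥ x with hw
  have e : w ⬝ᵥ w = x ⬝ᵥ (Z *ᵥ w) := by
    nth_rewrite 1 [hw]
    rw [mulVec_transpose, ← dotProduct_mulVec]
  -- For `w = Zᵀx`: `|w|⁴ = (x·Zw)² ≤ |x|²|Zw|² ≤ c|x|²|w|²`, then cancel `|w|²`.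
  have cs : (x ⬝ᵥ (Z *ᵥ w)) ^ 2 ≤ (x ⬝ᵥ x) * ((Z *ᵥ w) ⬝ᵥ (Z *ᵥ w)) := by
    simp only [dotProduct, ← sq]
    exact Finset.sum_mul_sq_le_sq_mul_sq _ _ _
  have hw0 : 0 ≤ w ⬝ᵥ w := by simpa using dotProduct_self_star_nonneg w
  have hx0 : 0 ≤ x ⬝ᵥ x := by simpa using dotProduct_self_star_nonneg x
  rw [← e] at cs
  rcases hw0.eq_or_lt with h0 | h0
  · rw [← h0]; simp only [sub_zero]; positivity
  · have : (w ⬝ᵥ w) ^ 2 ≤ (x ⬝ᵥ x) * (c * (w ⬝ᵥ w)) :=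
      cs.trans (mul_le_mul_of_nonneg_left (by linarith) hx0)
    have : (w ⬝ᵥ w) ≤ (x ⬝ᵥ x) * c := by
      apply le_of_mul_le_mul_right _ h0; nlinarith
    linarith

lemma Psi1_transpose {q : ℕ} (a : EuclideanSpace ℝ (VarIdx q)) : (Psi1 a)ᵀ = Psi1 a := by
  ext i j
  simp only [Psi1, transpose_apply, of_apply, max_comm, min_comm]

lemma eq_zero_of_Psi1_eq_zero {q : ℕ} {a : EuclideanSpace ℝ (VarIdx q)} (h1 : Psi1 a = 0)
    (h2 : errVar a = 0) : a = 0 := by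
  ext k
  rcases k with ⟨⟨i, j⟩, hij⟩ | ⟨⟩
  · have := congrFun (congrFun h1 i) j
    simpa [Psi1, max_eq_left hij, min_eq_right hij] using this
  · exact h2

variable {m q : ℕ} {n : Fin m → ℕ}

lemma Sig_transpose (Z : (i : Fin m) → Matrix (Fin (n i)) (Fin q) ℝ)
    (a : EuclideanSpace ℝ (VarIdx q)) : (Sig Z a)ᵀ = Sig Z a := by
  have : (Psi m a)ᵀ = Psi m a := by
    rw [Psi, blockDiagonal'_transpose]; simp only [Psi1_transpose]
  rw [Sig, transpose_add, transpose_mul, transpose_mul, this]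
  simp [Matrix.mul_assoc]

lemma posDef_Sig (Z : (i : Fin m) → Matrix (Fin (n i)) (Fin q) ℝ)
    {ψ : EuclideanSpace ℝ (VarIdx q)} (hψ : ψ ∈ paramSet q) : (Sig Z ψ).PosDef := by
  refine PosDef.posSemidef_add ?_ (PosDef.one.smul hψ.2)
  exact posSemidef_mul_mul_transpose (posSemidef_blockDiagonal' fun _ => hψ.1) _

/-- The constant relating the largest eigenvalue of a standardized direction to its information. -/
def clusterConst (c₁ c₂ : ℝ) : ℝ := 4 * c₂ ^ 4 * (1 + 1 / (c₁ - 1)) + 2 / (c₁ - 1)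

/-- In the clustered model, a covariance direction of unit information is uniformly small, as a
quadratic form relative to the covariance matrix, and the information is nondegenerate. The bound
is uniform in the parameter `ψ`, so no control of `‖ψ‖ / ψ_r` is needed. -/
theorem Sig_direction_bound (hm : 1 ≤ m) (hq : 1 ≤ q)
    (Z : (i : Fin m) → Matrix (Fin (n i)) (Fin q) ℝ)
    {ψ : EuclideanSpace ℝ (VarIdx q)} (hψ : ψ ∈ paramSet q)
    {c₁ c₂ : ℝ} (hc₁ : 1 < c₁) (hc₂ : 1 < c₂)
    (h_i : c₁ ≤ ((∑ i, (n i : ℝ)) / m) / q)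
    (h_ii : ∀ i, ∀ γ ∈ spectrum ℝ ((Z i)ᵀ * Z i), c₂⁻¹ ≤ γ ∧ γ ≤ c₂)
    (a : EuclideanSpace ℝ (VarIdx q)) :
    (infoForm (Sig Z ψ) (Sig Z a) = 0 → a = 0) ∧
    ∃ s : ℝ, 0 ≤ s ∧ (∀ x, |x ⬝ᵥ (Sig Z a *ᵥ x)| ≤ s * (x ⬝ᵥ (Sig Z ψ *ᵥ x))) ∧
      m * s ^ 2 ≤ clusterConst c₁ c₂ * infoForm (Sig Z ψ) (Sig Z a) := by
  have hc₂0 : 0 < c₂ := by linarith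
  have hr : 0 < errVar ψ := hψ.2
  have hGe : (blockZ Z)ᵀ * blockZ Z = blockDiagonal' fun i => (Z i)ᵀ * Z i := by
    rw [blockZ, blockDiagonal'_transpose, ← blockDiagonal'_mul]
  have hsc (c : ℝ) : (c • 1 : Matrix ((_ : Fin m) × Fin q) ((_ : Fin m) × Fin q) ℝ) =
      blockDiagonal' fun _ => c • 1 := by
    rw [← blockDiagonal'_one, ← blockDiagonal'_smul]; rfl
  have hsym (i : Fin m) : ((Z i)ᵀ * Z i)ᵀ = (Z i)ᵀ * Z i := by simp [transpose_mul]
  have hlow : ((blockZ Z)ᵀ * blockZ Z - c₂⁻¹ • 1).PosSemidef := by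
    rw [hGe, hsc, ← blockDiagonal'_sub]
    exact posSemidef_blockDiagonal' fun i =>
      posSemidef_sub_smul_of_spectrum (hsym i) fun γ hγ => (h_ii i γ hγ).1
  have hup : (c₂ • 1 - (blockZ Z)ᵀ * blockZ Z).PosSemidef := by
    rw [hGe, hsc, ← blockDiagonal'_sub]
    exact posSemidef_blockDiagonal' fun i =>
      posSemidef_smul_sub_of_spectrum (hsym i) fun γ hγ => (h_ii i γ hγ).2
  have hup' := posSemidef_smul_sub_mul_transpose hc₂0.le hup
  have hG : ((blockZ Z)ᵀ * blockZ Z).PosDef := by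
    have := PosDef.posSemidef_add hlow (PosDef.one.smul (inv_pos.2 hc₂0))
    simpa using this
  have hΨ : (Psi m ψ).PosSemidef := posSemidef_blockDiagonal' fun _ => hψ.1
  have hM : (Psi m a)ᵀ = Psi m a := by
    rw [Psi, blockDiagonal'_transpose]; simp only [Psi1_transpose]
  obtain ⟨l1, l2⟩ := infoForm_lower_bounds hG hc₂0 hlow hΨ hM hr (errVar a)
  change _ ≤ infoForm (Sig Z ψ) (Sig Z a) at l1
  change _ ≤ 2 * (infoForm (Sig Z ψ) (Sig Z a) - _) + _ at l2
  set F := infoForm (Sig Z ψ) (Sig Z a) with hF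
  -- The same block in every cluster: the Gram matrices of the `Z i` enter only through `c₂`.
  set D : Matrix (Fin q) (Fin q) ℝ := Psi1 ψ + (c₂ * errVar ψ) • 1 with hD
  have hDpd : D.PosDef := PosDef.posSemidef_add hψ.1 (PosDef.one.smul (by positivity))
  have hDe : Psi m ψ + (c₂ * errVar ψ) • 1 = blockDiagonal' fun _ => D := by
    rw [hsc, Psi, ← blockDiagonal'_add]; rfl
  have hk0 := infoForm_nonneg hDpd (Psi1_transpose a)
  rw [hDe, Psi, infoForm_blockDiagonal'_const _ _ ((isUnit_iff_isUnit_det _).1 hDpd.isUnit)] at l2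
  set k2 := infoForm D (Psi1 a) with hk2
  set t := errVar a / errVar ψ with ht
  have hcN : (Fintype.card (ObsIdx n) : ℝ) = ∑ i, (n i : ℝ) := by simp [Fintype.card_sigma]
  have hcK : (Fintype.card ((_ : Fin m) × Fin q) : ℝ) = m * q := by simp [Fintype.card_sigma]
  have hm0 : (0 : ℝ) < m := by exact_mod_cast hm
  have hq0 : (0 : ℝ) < q := by exact_mod_cast hq
  have hq1 : (1 : ℝ) ≤ q := by exact_mod_cast hq
  have hcard : c₁ * (m * q) ≤ ∑ i, (n i : ℝ) := by
    rw [div_div, le_div_iff₀ (by positivity)] at h_i; exact h_i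
  rw [hcN, hcK] at l1 l2
  have hc : 0 < c₁ - 1 := by linarith
  -- Condition (i) gives `n - mq ≥ (c₁ - 1) mq`, so the residual space alone determines `t` up to
  -- this error.
  have l3 : (m * q) * t ^ 2 ≤ F / (c₁ - 1) := by
    rw [le_div_iff₀ hc]
    refine le_trans ?_ l1
    have := mul_le_mul_of_nonneg_right hcard (sq_nonneg t)
    nlinarith
  have l4 : (m : ℝ) * t ^ 2 ≤ F / (c₁ - 1) := by
    refine le_trans ?_ l3
    have : (m : ℝ) * t ^ 2 ≤ (m * t ^ 2) * q := le_mul_of_one_le_right (by positivity) hq1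
    linarith
  have hnn : 0 ≤ (∑ i, (n i : ℝ) - m * q) * t ^ 2 := by
    refine mul_nonneg ?_ (sq_nonneg _)
    have : (0 : ℝ) ≤ (c₁ - 1) * (m * q) := by positivity
    linarith
  have l5 : m * k2 ≤ 2 * F * (1 + 1 / (c₁ - 1)) := by
    have : F / (c₁ - 1) = F * (1 / (c₁ - 1)) := by ring
    rw [this] at l3
    linarith
  -- `√k2` bounds each block `Psi1 a` relative to `D`, `c₂²` is the price of returning from `D` to
  -- `Σ(ψ)`, and `|t|` accounts for the error variance.
  refine ⟨fun h0 => ?_, c₂ ^ 2 * √k2 + |t|, by positivity, ?_, ?_⟩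
  · rw [h0] at l4 l5
    have t0 : t = 0 := by
      have : t ^ 2 ≤ 0 := by
        rw [zero_div] at l4
        exact nonpos_of_mul_nonpos_right l4 hm0
      exact pow_eq_zero_iff two_ne_zero |>.1 (le_antisymm this (sq_nonneg _))
    have k0 : k2 = 0 := by
      refine le_antisymm (nonpos_of_mul_nonpos_right (a := (m : ℝ)) (by linarith) hm0) hk0
    refine eq_zero_of_Psi1_eq_zero (eq_zero_of_infoForm_eq_zero hDpd (Psi1_transpose a) k0) ?_
    rw [ht, div_eq_zero_iff] at t0
    exact t0.resolve_right hr.ne'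
  · intro x
    have := abs_dotProduct_mulVec_mul_mul_transpose_add_le (M := Psi m a) hc₂.le hup' hΨ
      (Real.sqrt_nonneg k2) hr (errVar a) (fun y => ?_) x
    · rw [ht, abs_div, abs_of_pos hr]; exact this
    · rw [hDe, Psi]
      have e1 := dotProduct_blockDiagonal'_mulVec (fun _ : Fin m => Psi1 a) y
      have e2 := dotProduct_blockDiagonal'_mulVec (fun _ : Fin m => D) y
      rw [e1, e2, Finset.mul_sum]
      exact (Finset.abs_sum_le_sum_abs _ _).trans (Finset.sum_le_sum fun i _ =>
        abs_dotProduct_mulVec_le_infoForm hDpd (Psi1_transpose a) _)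
  · have i1 : (c₂ ^ 2 * √k2 + |t|) ^ 2 ≤ 2 * (c₂ ^ 4 * k2) + 2 * t ^ 2 := by
      have := add_sq_le (a := c₂ ^ 2 * √k2) (b := |t|)
      rw [mul_pow, Real.sq_sqrt hk0, sq_abs] at this
      linarith
    have i2 := mul_le_mul_of_nonneg_left i1 hm0.le
    have i3 := mul_le_mul_of_nonneg_left l5 (by positivity : 0 ≤ 2 * c₂ ^ 4)
    rw [clusterConst, add_mul]
    have : 2 / (c₁ - 1) * F = 2 * (F / (c₁ - 1)) := by ring
    rw [this]
    linarith

end ClusterBounds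

/-! ### Quadratic polynomials in one standard normal variable -/

section OneDimensional

/-- Derivatives of the moment generating function keep the shape polynomial times `exp(t²/2)`, so
moments come from iterating `p ↦ p' + t p`. -/
lemma deriv_mul_exp_half_sq (p p' : ℝ → ℝ) (hp : ∀ t, HasDerivAt p (p' t) t) :
    deriv (fun t => p t * Real.exp (t ^ 2 / 2)) =
      fun t => (p' t + t * p t) * Real.exp (t ^ 2 / 2) := by
  funext t
  have h1 : HasDerivAt (fun t : ℝ => t ^ 2 / 2) t t := by
    have := (hasDerivAt_pow 2 t).div_const 2
    simpa using this
  have := (hp t).fun_mul h1.exp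
  rw [this.deriv]; ring

/-- The factor `1 *` puts the generating function in the shape differentiated by
`deriv_mul_exp_half_sq`. -/
lemma integral_pow_gaussianReal (k : ℕ) :
    ∫ x, x ^ k ∂(gaussianReal 0 1) =
      iteratedDeriv k (fun t : ℝ => 1 * Real.exp (t ^ 2 / 2)) 0 := by
  have h0 : (0 : ℝ) ∈ interior (integrableExpSet id (gaussianReal 0 1)) := by
    rw [integrableExpSet_id_gaussianReal]; simp
  have := iteratedDeriv_mgf_zero h0 k
  rw [mgf_id_gaussianReal] at this
  simpa using this.symm

lemma gaussian_moments :
    ∫ x, x ∂(gaussianReal 0 1) = 0 ∧ ∫ x, x ^ 2 ∂(gaussianReal 0 1) = 1 ∧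
      ∫ x, x ^ 3 ∂(gaussianReal 0 1) = 0 ∧ ∫ x, x ^ 4 ∂(gaussianReal 0 1) = 3 := by
  have d1 := deriv_mul_exp_half_sq (fun _ => 1) (fun _ => 0) fun t => hasDerivAt_const t 1
  have d2 := deriv_mul_exp_half_sq (fun t => t) (fun _ => 1) fun t => hasDerivAt_id t
  have d3 := deriv_mul_exp_half_sq (fun t => 1 + t ^ 2) (fun t => 2 * t) fun t => by
    simpa using (hasDerivAt_pow 2 t).const_add 1
  have d4 := deriv_mul_exp_half_sq (fun t => 3 * t + t ^ 3) (fun t => 3 + 3 * t ^ 2)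
    fun t => by simpa using ((hasDerivAt_id t).const_mul 3).fun_add (hasDerivAt_pow 3 t)
  have e1 : deriv (fun t : ℝ => 1 * Real.exp (t ^ 2 / 2)) = fun t => t * Real.exp (t ^ 2 / 2) := by
    rw [d1]; funext t; ring
  have e2 : deriv (fun t : ℝ => t * Real.exp (t ^ 2 / 2)) =
      fun t => (1 + t ^ 2) * Real.exp (t ^ 2 / 2) := by rw [d2]; funext t; ring
  have e3 : deriv (fun t : ℝ => (1 + t ^ 2) * Real.exp (t ^ 2 / 2)) =
      fun t => (3 * t + t ^ 3) * Real.exp (t ^ 2 / 2) := by rw [d3]; funext t; ring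
  have h (k : ℕ) := integral_pow_gaussianReal k
  refine ⟨?_, ?_, ?_, ?_⟩
  · simp
  · rw [h]; simp only [iteratedDeriv_succ', iteratedDeriv_zero, e1, e2]; simp
  · rw [h]; simp only [iteratedDeriv_succ', iteratedDeriv_zero, e1, e2, e3]; simp
  · rw [h]; simp only [iteratedDeriv_succ', iteratedDeriv_zero, e1, e2, e3, d4]; simp

lemma integrable_pow_gaussianReal (k : ℕ) : Integrable (fun x : ℝ => x ^ k) (gaussianReal 0 1) :=
  integrable_pow_of_mem_interior_integrableExpSet (X := id)
    (by rw [integrableExpSet_id_gaussianReal]; simp) k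

lemma memLp_two_quadratic (c b : ℝ) :
    MemLp (fun x : ℝ => b * x + c * x ^ 2) 2 (gaussianReal 0 1) := by
  rw [memLp_two_iff_integrable_sq (by fun_prop)]
  have : (fun x : ℝ => (b * x + c * x ^ 2) ^ 2) =
      fun x => b ^ 2 * x ^ 2 + 2 * b * c * x ^ 3 + c ^ 2 * x ^ 4 := by funext x; ring
  rw [this]
  exact (((integrable_pow_gaussianReal 2).const_mul _).add
    ((integrable_pow_gaussianReal 3).const_mul _)).add ((integrable_pow_gaussianReal 4).const_mul _)

lemma variance_quadratic (c b : ℝ) :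
    Var[fun x : ℝ => b * x + c * x ^ 2; gaussianReal 0 1] = b ^ 2 + 2 * c ^ 2 := by
  obtain ⟨m1, m2, m3, m4⟩ := gaussian_moments
  have i1 : Integrable (fun x : ℝ => x) (gaussianReal 0 1) := by
    simpa using integrable_pow_gaussianReal 1
  have i2 := integrable_pow_gaussianReal 2
  have i3 := integrable_pow_gaussianReal 3
  have i4 := integrable_pow_gaussianReal 4
  rw [variance_eq_sub (memLp_two_quadratic c b)]
  have e : ((fun x : ℝ => b * x + c * x ^ 2) ^ 2) =
      fun x => b ^ 2 * x ^ 2 + 2 * b * c * x ^ 3 + c ^ 2 * x ^ 4 := by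
    funext x; simp only [Pi.pow_apply]; ring
  have i23 : Integrable (fun x : ℝ => b ^ 2 * x ^ 2 + 2 * b * c * x ^ 3) (gaussianReal 0 1) :=
    (i2.const_mul _).add (i3.const_mul _)
  simp only [e]
  rw [integral_add i23 (i4.const_mul _),
    integral_add (i2.const_mul _) (i3.const_mul _), integral_add (i1.const_mul _) (i2.const_mul _)]
  have m1' : ∫ x, b * x ∂(gaussianReal 0 1) = 0 := by rw [integral_const_mul, m1, mul_zero]
  simp only [integral_const_mul, m1', m2, m3, m4]
  ring

open Complex in
lemma integral_cexp_quadratic_gaussianReal (c b t : ℝ) :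
    ∫ x, cexp ((t * (b * x + c * x ^ 2) : ℝ) * I) ∂(gaussianReal 0 1) =
      cexp (-(1 / 2) * log (1 - 2 * I * t * c) - t ^ 2 * b ^ 2 / (2 * (1 - 2 * I * t * c))) := by
  -- The Gaussian integral converges and the principal logarithm of `w` is safe because `Re w = 1`.
  set w : ℂ := 1 - 2 * I * t * c with hw
  have hre : w.re = 1 := by simp [hw]
  have hw0 : w ≠ 0 := fun h => by rw [h] at hre; simp at hre
  have hb : (-w / 2).re < 0 := by
    have : (-w / 2).re = -w.re / 2 := by simp
    rw [this, hre]; norm_num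
  have key := integral_cexp_quadratic hb (I * t * b) 0
  rw [integral_gaussianReal_eq_integral_smul one_ne_zero]
  have e1 : ∀ x : ℝ, gaussianPDFReal 0 1 x • cexp ((t * (b * x + c * x ^ 2) : ℝ) * I) =
      ((√(2 * Real.pi))⁻¹ : ℝ) * cexp (-w / 2 * x ^ 2 + I * t * b * x + 0) := by
    intro x
    rw [gaussianPDFReal, Complex.real_smul]
    push_cast
    rw [mul_assoc, ← Complex.exp_add, hw]
    simp only [mul_one]
    congr 2
    ring
  simp_rw [e1]
  rw [integral_const_mul, key]
  have hpi : (0 : ℝ) < 2 * Real.pi := by positivity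
  have harg : w.arg ≠ Real.pi := by
    intro h
    rw [Complex.arg_eq_pi_iff] at h
    linarith [h.1]
  have e2 : ((Real.pi : ℂ) / -(-w / 2)) ^ (1 / 2 : ℂ) =
      ((√(2 * Real.pi) : ℝ) : ℂ) * cexp (-(1 / 2) * log w) := by
    have : (Real.pi : ℂ) / -(-w / 2) = ((2 * Real.pi : ℝ) : ℂ) * w⁻¹ := by
      push_cast; field_simp
    rw [this, Complex.cpow_def_of_ne_zero (mul_ne_zero (by exact_mod_cast hpi.ne') (inv_ne_zero hw0)),
      Complex.log_ofReal_mul hpi (inv_ne_zero hw0), Complex.log_inv _ harg, Real.sqrt_eq_rpow,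
      Real.rpow_def_of_pos hpi, Complex.ofReal_exp, ← Complex.exp_add]
    congr 1
    push_cast; ring
  have e3 : (0 : ℂ) - (I * t * b) ^ 2 / (4 * (-w / 2)) = - (t ^ 2 * b ^ 2 / (2 * w)) := by
    rw [mul_pow, mul_pow, I_sq]; field_simp; ring
  rw [e2, e3, mul_assoc, ← mul_assoc, ← Complex.ofReal_mul, inv_mul_cancel₀ (by positivity),
    ofReal_one, one_mul, ← Complex.exp_add, sub_eq_add_neg]

open Complex in
/-- The cumulant function of a centred quadratic polynomial in a standard normal variable is close
to that of a normal variable of the same variance. -/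
lemma norm_cumulant_sub_le (c b t δ : ℝ) (hc : |c| ≤ δ) (hδ : 2 * |t| * δ ≤ 1 / 2) :
    ‖(-(1 / 2) * log (1 - 2 * I * t * c) - t ^ 2 * b ^ 2 / (2 * (1 - 2 * I * t * c)) - I * t * c) -
      (-(t ^ 2 * (b ^ 2 + 2 * c ^ 2) / 2))‖ ≤ 2 * |t| ^ 3 * δ * (b ^ 2 + 2 * c ^ 2) := by
  set z : ℂ := -(2 * I * t * c) with hz
  have hzn : ‖z‖ = 2 * |t| * |c| := by
    rw [hz, norm_neg]; simp
  have hzd : ‖z‖ ≤ 2 * |t| * δ := by rw [hzn]; gcongr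
  have hz2 : ‖z‖ ≤ 1 / 2 := hzd.trans hδ
  have hz1 : ‖z‖ < 1 := by linarith
  have h1z : 1 / 2 ≤ ‖1 + z‖ := by
    have := norm_sub_norm_le (1 : ℂ) (-z)
    rw [norm_one, norm_neg, sub_neg_eq_add] at this
    linarith
  have h1z0 : (1 + z) ≠ 0 := fun h => by rw [h, norm_zero] at h1z; norm_num at h1z
  have hlog := norm_log_sub_logTaylor_le 2 hz1
  have hT : logTaylor 3 z = z - z ^ 2 / 2 := by
    simp only [logTaylor, Finset.sum_range_succ, Finset.sum_range_zero]
    norm_num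
    ring
  rw [show 2 + 1 = 3 from rfl, hT] at hlog
  have hlog' : ‖log (1 + z) - (z - z ^ 2 / 2)‖ ≤ 2 / 3 * ‖z‖ ^ 3 := by
    refine hlog.trans ?_
    have : (1 - ‖z‖)⁻¹ ≤ 2 := by
      rw [inv_le_comm₀ (by linarith) (by norm_num)]; linarith
    calc ‖z‖ ^ 3 * (1 - ‖z‖)⁻¹ / ((2 : ℕ) + 1) ≤ ‖z‖ ^ 3 * 2 / ((2 : ℕ) + 1) := by gcongr
      _ = 2 / 3 * ‖z‖ ^ 3 := by norm_num; ring
  have hz_sq : z ^ 2 = -(4 * t ^ 2 * c ^ 2) := by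
    rw [hz, neg_sq, mul_pow, mul_pow, mul_pow, I_sq]; ring
  -- The centring cancels the linear term of the logarithm, and its quadratic term supplies `-t²c²`.
  -- What remains is the cubic Taylor remainder and the effect of `1/(1+z)` on the `b²` term.
  have e : (-(1 / 2) * log (1 - 2 * I * t * c) - t ^ 2 * b ^ 2 / (2 * (1 - 2 * I * t * c)) -
      I * t * c) - (-(t ^ 2 * (b ^ 2 + 2 * c ^ 2) / 2)) =
      -(1 / 2) * (log (1 + z) - (z - z ^ 2 / 2)) + t ^ 2 * b ^ 2 / 2 * (z / (1 + z)) := by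
    have : (1 : ℂ) - 2 * I * t * c = 1 + z := by rw [hz]; ring
    rw [this]
    have h2 : (t : ℂ) ^ 2 * b ^ 2 / 2 * (z / (1 + z)) =
      t ^ 2 * b ^ 2 / 2 - t ^ 2 * b ^ 2 / (2 * (1 + z)) := by field_simp; ring
    rw [h2, mul_sub, hz_sq]
    have h3 : I * t * c = -z / 2 := by rw [hz]; ring
    rw [h3]; ring
  rw [e]
  have n1 : ‖-(1 / 2) * (log (1 + z) - (z - z ^ 2 / 2))‖ ≤ 1 / 3 * ‖z‖ ^ 3 := by
    rw [norm_mul]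
    have : ‖(-(1 / 2) : ℂ)‖ = 1 / 2 := by simp
    rw [this]; linarith
  have n2 : ‖(t : ℂ) ^ 2 * b ^ 2 / 2 * (z / (1 + z))‖ ≤ t ^ 2 * b ^ 2 * ‖z‖ := by
    rw [norm_mul, norm_div, norm_div, norm_mul, norm_pow, norm_pow, Complex.norm_real,
      Complex.norm_real, Real.norm_eq_abs, Real.norm_eq_abs, sq_abs, sq_abs]
    have : ‖z‖ / ‖1 + z‖ ≤ 2 * ‖z‖ := by
      rw [div_le_iff₀ (by linarith)]
      nlinarith [norm_nonneg z]
    calc t ^ 2 * b ^ 2 / ‖(2 : ℂ)‖ * (‖z‖ / ‖1 + z‖) ≤ t ^ 2 * b ^ 2 / ‖(2 : ℂ)‖ * (2 * ‖z‖) := by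
          gcongr
      _ = _ := by simp; ring
  have n3 : ‖z‖ ^ 3 = ‖z‖ * (4 * t ^ 2 * c ^ 2) := by
    rw [pow_succ' ‖z‖ 2, hzn, mul_pow, mul_pow, sq_abs, sq_abs]; ring
  -- One factor `‖z‖ ≤ 2|t|δ` is pulled out; the rest is at most `t²` times the variance, so the
  -- errors can be summed over coordinates.
  calc _ ≤ 1 / 3 * ‖z‖ ^ 3 + t ^ 2 * b ^ 2 * ‖z‖ := (norm_add_le _ _).trans (add_le_add n1 n2)
    _ = ‖z‖ * (t ^ 2 * (b ^ 2 + 4 / 3 * c ^ 2)) := by rw [n3]; ring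
    _ ≤ (2 * |t| * δ) * (t ^ 2 * (b ^ 2 + 2 * c ^ 2)) := by
        have : b ^ 2 + 4 / 3 * c ^ 2 ≤ b ^ 2 + 2 * c ^ 2 := by nlinarith [sq_nonneg c]
        have h0 : 0 ≤ δ := (abs_nonneg c).trans hc
        gcongr
    _ = _ := by rw [← sq_abs t]; ring

end OneDimensional

/-! ### Quadratic polynomials in a standard normal vector -/

section QuadraticForms

variable {N : Type*} [Fintype N] [DecidableEq N]

/-- Orthogonal diagonalization of a quadratic polynomial on Euclidean space. -/
lemma exists_orthonormal_diagonalization {A : Matrix N N ℝ} (hA : Aᵀ = A) :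
    ∃ (e : OrthonormalBasis N ℝ (EuclideanSpace ℝ N)) (c : N → ℝ),
      (∀ i, A *ᵥ ofLp (e i) = c i • ofLp (e i)) ∧ ∑ i, c i = A.trace ∧
      ∑ i, c i ^ 2 = (A * A).trace := by
  have hH : A.IsHermitian := by rw [Matrix.IsHermitian, conjTranspose_eq_transpose_of_trivial, hA]
  refine ⟨hH.eigenvectorBasis, hH.eigenvalues, fun i => hH.mulVec_eigenvectorBasis i, ?_, ?_⟩
  · simpa using hH.trace_eq_sum_eigenvalues.symm
  · conv_rhs => rw [hH.spectral_theorem, ← map_mul, Unitary.conjStarAlgAut_apply, trace_mul_comm,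
      ← mul_assoc, Unitary.coe_star_mul_self, one_mul, diagonal_mul_diagonal, trace_diagonal]
    simp [sq]

lemma ofLp_dotProduct_ofLp (x y : EuclideanSpace ℝ N) : ofLp x ⬝ᵥ ofLp y = inner ℝ y x := by
  rw [EuclideanSpace.inner_eq_star_dotProduct]; simp

lemma quadratic_diagonalize {A : Matrix N N ℝ} (b : N → ℝ)
    {e : OrthonormalBasis N ℝ (EuclideanSpace ℝ N)} {c : N → ℝ}
    (he : ∀ i, A *ᵥ ofLp (e i) = c i • ofLp (e i)) (x : N → ℝ) :
    b ⬝ᵥ ofLp (∑ i, x i • e i) + ofLp (∑ i, x i • e i) ⬝ᵥ (A *ᵥ ofLp (∑ i, x i • e i)) =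
      ∑ i, ((b ⬝ᵥ ofLp (e i)) * x i + c i * x i ^ 2) := by
  have h1 : b ⬝ᵥ ofLp (∑ i, x i • e i) = ∑ i, (b ⬝ᵥ ofLp (e i)) * x i := by
    rw [ofLp_sum, dotProduct_sum]
    refine Finset.sum_congr rfl fun i _ => ?_
    rw [ofLp_smul, dotProduct_smul, smul_eq_mul, mul_comm]
  have h2 : A *ᵥ ofLp (∑ i, x i • e i) = ofLp (∑ i, (x i * c i) • e i) := by
    rw [ofLp_sum, mulVec_sum, ofLp_sum]
    refine Finset.sum_congr rfl fun i _ => ?_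
    rw [ofLp_smul, mulVec_smul, he, smul_smul, ofLp_smul]
  rw [h1, h2, ofLp_dotProduct_ofLp, e.orthonormal.inner_sum, ← Finset.sum_add_distrib]
  refine Finset.sum_congr rfl fun i _ => ?_
  simp; ring

lemma sum_sq_dotProduct_orthonormalBasis (b : N → ℝ)
    (e : OrthonormalBasis N ℝ (EuclideanSpace ℝ N)) :
    ∑ i, (b ⬝ᵥ ofLp (e i)) ^ 2 = b ⬝ᵥ b := by
  have h := e.sum_sq_inner_right (toLp 2 b)
  have h3 : ‖toLp 2 b‖ ^ 2 = b ⬝ᵥ b := by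
    rw [← real_inner_self_eq_norm_sq, ← ofLp_dotProduct_ofLp]
  rw [← h3, ← h]
  refine Finset.sum_congr rfl fun i _ => ?_
  rw [← ofLp_dotProduct_ofLp]

/-- By rotation invariance the coordinates in an eigenbasis of `A` are independent standard normals,
and variances add. -/
lemma memLp_two_and_variance_quadratic_stdGaussian {A : Matrix N N ℝ} (hA : Aᵀ = A) (b : N → ℝ) :
    MemLp (fun w : EuclideanSpace ℝ N => b ⬝ᵥ ofLp w + ofLp w ⬝ᵥ (A *ᵥ ofLp w)) 2
        (stdGaussian (EuclideanSpace ℝ N)) ∧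
      Var[fun w : EuclideanSpace ℝ N => b ⬝ᵥ ofLp w + ofLp w ⬝ᵥ (A *ᵥ ofLp w);
        stdGaussian (EuclideanSpace ℝ N)] = b ⬝ᵥ b + 2 * (A * A).trace := by
  obtain ⟨e, c, he, -, hc2⟩ := exists_orthonormal_diagonalization hA
  have hcont : Continuous
      fun w : EuclideanSpace ℝ N => b ⬝ᵥ ofLp w + ofLp w ⬝ᵥ (A *ᵥ ofLp w) := by fun_prop
  have hmap : AEMeasurable (fun x : N → ℝ => ∑ i, x i • e i)
      (Measure.pi fun _ : N => gaussianReal 0 1) := Measurable.aemeasurable (by fun_prop)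
  have hcomp : (fun w : EuclideanSpace ℝ N => b ⬝ᵥ ofLp w + ofLp w ⬝ᵥ (A *ᵥ ofLp w)) ∘
      (fun x : N → ℝ => ∑ i, x i • e i) =
      ∑ i, fun x : N → ℝ => ((b ⬝ᵥ ofLp (e i)) * x i + c i * x i ^ 2) := by
    funext x
    simp only [Function.comp_apply, Finset.sum_apply]
    exact quadratic_diagonalize b he x
  rw [stdGaussian_eq_map_pi_orthonormalBasis e]
  constructor
  · rw [memLp_map_measure_iff hcont.aestronglyMeasurable hmap, hcomp]
    refine memLp_finsetSum' _ fun i _ => ?_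
    exact (memLp_two_quadratic (c i) (b ⬝ᵥ ofLp (e i))).comp_measurePreserving
      (measurePreserving_eval (fun _ : N => gaussianReal 0 1) i)
  · rw [variance_map hcont.aemeasurable hmap, hcomp,
      variance_sum_pi (X := fun i x => (b ⬝ᵥ ofLp (e i)) * x + c i * x ^ 2)
        fun i => memLp_two_quadratic (c i) _]
    simp only [variance_quadratic]
    rw [Finset.sum_add_distrib, sum_sq_dotProduct_orthonormalBasis, ← Finset.mul_sum, hc2]

open Complex in
/-- A standardized quadratic polynomial in independent normal variables has a characteristic
function close to the Gaussian one if all its eigenvalues are small. -/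
lemma exists_charFun_quadratic_stdGaussian_eq {A : Matrix N N ℝ} (hA : Aᵀ = A) (b : N → ℝ)
    (hvar : b ⬝ᵥ b + 2 * (A * A).trace = 1) {δ : ℝ}
    (hδA : ∀ y, |y ⬝ᵥ (A *ᵥ y)| ≤ δ * (y ⬝ᵥ y)) {t : ℝ} (hδ : 2 * |t| * δ ≤ 1 / 2) :
    ∃ η : ℂ, ‖η‖ ≤ 2 * |t| ^ 3 * δ ∧
      ∫ w : EuclideanSpace ℝ N,
        cexp ((t * (b ⬝ᵥ ofLp w + ofLp w ⬝ᵥ (A *ᵥ ofLp w) - A.trace) : ℝ) * I)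
        ∂(stdGaussian (EuclideanSpace ℝ N)) = cexp (-(t ^ 2 / 2) + η) := by
  obtain ⟨e, c, he, hc1, hc2⟩ := exists_orthonormal_diagonalization hA
  have hc (i : N) : |c i| ≤ δ := by
    have h := hδA (ofLp (e i))
    rw [he, dotProduct_smul, ofLp_dotProduct_ofLp, real_inner_self_eq_norm_sq, e.norm_eq_one] at h
    simpa using h
  set β : N → ℝ := fun i => b ⬝ᵥ ofLp (e i) with hβ
  have hsum : ∑ i, (β i ^ 2 + 2 * c i ^ 2) = 1 := by
    rw [Finset.sum_add_distrib, sum_sq_dotProduct_orthonormalBasis, ← Finset.mul_sum, hc2, hvar]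
  set g : N → ℂ := fun i => -(1 / 2) * log (1 - 2 * I * t * c i) -
    t ^ 2 * β i ^ 2 / (2 * (1 - 2 * I * t * c i)) - I * t * c i with hg
  have hgb (i : N) : ‖g i - (-(t ^ 2 * (β i ^ 2 + 2 * c i ^ 2) / 2))‖ ≤
      2 * |t| ^ 3 * δ * (β i ^ 2 + 2 * c i ^ 2) := norm_cumulant_sub_le (c i) (β i) t δ (hc i) hδ
  refine ⟨∑ i, (g i - (-(t ^ 2 * (β i ^ 2 + 2 * c i ^ 2) / 2))), ?_, ?_⟩
  · calc _ ≤ ∑ i, 2 * |t| ^ 3 * δ * (β i ^ 2 + 2 * c i ^ 2) :=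
          (norm_sum_le _ _).trans (Finset.sum_le_sum fun i _ => hgb i)
      _ = _ := by rw [← Finset.mul_sum, hsum, mul_one]
  · rw [stdGaussian_eq_map_pi_orthonormalBasis e, integral_map
      (Measurable.aemeasurable (by fun_prop)) (Continuous.aestronglyMeasurable (by fun_prop))]
    -- Because `tr A` is the sum of the eigenvalues, the centring is shared out among the
    -- coordinates and the integrand factorizes.
    have hprod (x : N → ℝ) : cexp ((t * (b ⬝ᵥ ofLp (∑ i, x i • e i) +
        ofLp (∑ i, x i • e i) ⬝ᵥ (A *ᵥ ofLp (∑ i, x i • e i)) - A.trace) : ℝ) * I) =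
        ∏ i, (cexp ((t * (β i * x i + c i * x i ^ 2) : ℝ) * I) * cexp (-(I * t * c i))) := by
      rw [quadratic_diagonalize b he, ← hc1, ← Finset.sum_sub_distrib, Finset.mul_sum]
      push_cast
      rw [Finset.sum_mul, Complex.exp_sum]
      refine Finset.prod_congr rfl fun i _ => ?_
      rw [← Complex.exp_add]
      congr 1
      simp only [hβ]; ring
    simp_rw [hprod]
    rw [integral_fintype_prod_eq_prod (f := fun i (x : ℝ) =>
      cexp ((t * (β i * x + c i * x ^ 2) : ℝ) * I) * cexp (-(I * t * c i)))]
    simp_rw [integral_mul_const, integral_cexp_quadratic_gaussianReal, ← Complex.exp_add]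
    rw [← Complex.exp_sum]
    congr 1
    have h1 : (t : ℂ) ^ 2 / 2 = ∑ i, ((t : ℂ) ^ 2 * (β i ^ 2 + 2 * c i ^ 2) / 2) := by
      have : ((∑ i, (β i ^ 2 + 2 * c i ^ 2) : ℝ) : ℂ) = 1 := by rw [hsum]; simp
      push_cast at this
      rw [← Finset.sum_div, ← Finset.mul_sum, this, mul_one]
    rw [h1, ← Finset.sum_neg_distrib, ← Finset.sum_add_distrib]
    refine Finset.sum_congr rfl fun i _ => ?_
    simp only [hg]; ring

end QuadraticForms

/-! ### Derivatives of determinants and inverses -/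

section MatrixCalculus

variable {E : Type*} [NormedAddCommGroup E] [NormedSpace ℝ E]
variable {N : Type*} [Fintype N] [DecidableEq N]

lemma differentiableAt_det {M : E → Matrix N N ℝ} {θ : E}
    (h : ∀ i j, DifferentiableAt ℝ (fun θ => M θ i j) θ) :
    DifferentiableAt ℝ (fun θ => (M θ).det) θ := by
  simp only [det_apply]
  refine DifferentiableAt.fun_sum fun σ _ => ?_
  refine DifferentiableAt.const_smul ?_ _
  have := HasFDerivAt.finsetProd (u := Finset.univ) (g := fun i θ => M θ (σ i) i)
    (g' := fun i => fderiv ℝ (fun θ => M θ (σ i) i) θ) (x := θ) fun i _ => (h _ _).hasFDerivAt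
  exact this.differentiableAt

lemma differentiableAt_inv_apply {M : E → Matrix N N ℝ} {θ : E}
    (h : ∀ i j, DifferentiableAt ℝ (fun θ => M θ i j) θ) (h0 : (M θ).det ≠ 0) (i j : N) :
    DifferentiableAt ℝ (fun θ => (M θ)⁻¹ i j) θ := by
  simp only [inv_def, Matrix.smul_apply, adjugate_apply, Ring.inverse_eq_inv', smul_eq_mul]
  refine ((differentiableAt_det h).fun_inv h0).fun_mul (differentiableAt_det fun k l => ?_)
  simp only [updateRow_apply]
  split_ifs
  · exact differentiableAt_const _
  · exact h k l

/-- After factoring out `det S`, the polynomial `det(1 + s S⁻¹H)` has linear coefficient `tr(S⁻¹H)`.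
-/
lemma hasDerivAt_det_add_smul {S H : Matrix N N ℝ} (hS : IsUnit S.det) :
    HasDerivAt (fun s : ℝ => (S + s • H).det) (S.det * (S⁻¹ * H).trace) 0 := by
  have e : (fun s : ℝ => (S + s • H).det) = fun s => S.det * (1 + (S⁻¹ * H).trace * s +
      (det (1 + (Polynomial.X : Polynomial ℝ) •
        (S⁻¹ * H).map Polynomial.C)).divX.divX.eval s * s ^ 2) := by
    funext s
    rw [← det_one_add_smul, ← det_mul, Matrix.mul_add, Matrix.mul_one, Matrix.mul_smul,
      mul_nonsing_inv_cancel_left _ _ hS]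
  rw [e]
  set Q := (det (1 + (Polynomial.X : Polynomial ℝ) • (S⁻¹ * H).map Polynomial.C)).divX.divX
  have h1 : HasDerivAt (fun s : ℝ => 1 + (S⁻¹ * H).trace * s) ((S⁻¹ * H).trace) 0 := by
    simpa using ((hasDerivAt_id (0 : ℝ)).const_mul (S⁻¹ * H).trace).const_add 1
  have h2 : HasDerivAt (fun s : ℝ => Q.eval s * s ^ 2) 0 0 := by
    simpa using (Q.hasDerivAt 0).fun_mul (hasDerivAt_pow 2 (0 : ℝ))
  simpa using (h1.fun_add h2).const_mul S.det

lemma hasDerivAt_inv_add_smul_apply {S H : Matrix N N ℝ} (hS : IsUnit S.det) (i j : N) :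
    HasDerivAt (fun s : ℝ => (S + s • H)⁻¹ i j) (-(S⁻¹ * H * S⁻¹) i j) 0 := by
  have hlin (k l : N) : HasDerivAt (fun s : ℝ => (S + s • H) k l) (H k l) 0 := by
    simpa using ((hasDerivAt_id (0 : ℝ)).mul_const (H k l)).const_add (S k l)
  have h0 : (S + (0 : ℝ) • H).det ≠ 0 := by simpa using hS.ne_zero
  have hd (k l : N) : DifferentiableAt ℝ (fun s : ℝ => (S + s • H)⁻¹ k l) 0 :=
    differentiableAt_inv_apply (fun k l => (hlin k l).differentiableAt) h0 k l
  set K' : Matrix N N ℝ := of fun k l => deriv (fun s : ℝ => (S + s • H)⁻¹ k l) 0 with hK'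
  have hev : ∀ᶠ s : ℝ in 𝓝 0, (S + s • H).det ≠ 0 :=
    (differentiableAt_det fun k l => (hlin k l).differentiableAt).continuousAt.eventually_ne h0
  -- Differentiate `(S + sH)(S + sH)⁻¹ = 1`, valid near 0; differentiability of the inverse is
  -- already known from the cofactor formula.
  have hprod : H * S⁻¹ + S * K' = 0 := by
    ext k l
    have d : HasDerivAt (fun s : ℝ => ∑ x, (S + s • H) k x * (S + s • H)⁻¹ x l)
        (∑ x, (H k x * (S + (0 : ℝ) • H)⁻¹ x l + (S + (0 : ℝ) • H) k x * K' x l)) 0 :=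
      HasDerivAt.fun_sum fun x _ => (hlin k x).fun_mul (hd x l).hasDerivAt
    have c : (fun s : ℝ => ∑ x, (S + s • H) k x * (S + s • H)⁻¹ x l) =ᶠ[𝓝 0]
        fun _ => (1 : Matrix N N ℝ) k l := by
      filter_upwards [hev] with s hs
      rw [← Matrix.mul_apply, mul_nonsing_inv _ (isUnit_iff_ne_zero.2 hs)]
    have := d.unique ((hasDerivAt_const (0 : ℝ) ((1 : Matrix N N ℝ) k l)).congr_of_eventuallyEq c)
    simpa [Matrix.add_apply, Matrix.mul_apply, Finset.sum_add_distrib] using this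
  have hK : K' = -(S⁻¹ * H * S⁻¹) := by
    have : S * K' = -(H * S⁻¹) := by rw [eq_neg_iff_add_eq_zero, add_comm]; exact hprod
    rw [← nonsing_inv_mul_cancel_left S K' hS, this, Matrix.mul_neg, Matrix.mul_assoc]
  have := (hd i j).hasDerivAt
  rwa [show deriv (fun s : ℝ => (S + s • H)⁻¹ i j) 0 = K' i j from rfl, hK] at this

end MatrixCalculus

/-! ### The score of a Gaussian family with linear mean and covariance -/

section Score

variable {N ι : Type*} [Fintype N] [DecidableEq N] [Fintype ι] [DecidableEq ι]

/-- The directional derivative of the Gaussian log-likelihood at residual `ε`, when the mean moves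
in the direction `d` and the covariance matrix in the direction `H`. -/
def scoreForm (S H : Matrix N N ℝ) (d ε : N → ℝ) : ℝ :=
  (S⁻¹ *ᵥ d) ⬝ᵥ ε + 1 / 2 * (ε ⬝ᵥ ((S⁻¹ * H * S⁻¹) *ᵥ ε) - (S⁻¹ * H).trace)

variable {μ : EuclideanSpace ℝ ι → EuclideanSpace ℝ N} {S : EuclideanSpace ℝ ι → Matrix N N ℝ}

lemma differentiableAt_logLik (hμ : IsLinearMap ℝ μ) (hS : IsLinearMap ℝ S)
    {θ : EuclideanSpace ℝ ι} (hθ : (S θ).PosDef) (y : EuclideanSpace ℝ N) :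
    DifferentiableAt ℝ (fun θ' => logLik μ S θ' y) θ := by
  have hμd : Differentiable ℝ μ := (LinearMap.toContinuousLinearMap (hμ.mk' μ)).differentiable
  have hSd (i j : N) : Differentiable ℝ fun θ' => S θ' i j := by
    have hl : IsLinearMap ℝ fun θ' => S θ' i j :=
      ⟨fun x y => by rw [hS.map_add]; rfl, fun c x => by rw [hS.map_smul]; rfl⟩
    exact (LinearMap.toContinuousLinearMap (hl.mk' _)).differentiable
  have hdet0 : (S θ).det ≠ 0 := hθ.det_pos.ne'
  have h1 := (differentiableAt_det (θ := θ) fun i j => (hSd i j).differentiableAt).log hdet0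
  have h2 (i : N) : DifferentiableAt ℝ (fun θ' => (y - μ θ') i) θ := by
    have : Differentiable ℝ fun θ' => (y - μ θ') i := by fun_prop
    exact this.differentiableAt
  unfold logLik
  refine DifferentiableAt.const_mul (h1.fun_add ?_) _
  simp only [dotProduct, mulVec]
  refine DifferentiableAt.fun_sum fun i _ => (h2 i).fun_mul ?_
  exact DifferentiableAt.fun_sum fun j _ =>
    (differentiableAt_inv_apply (fun i j => (hSd i j).differentiableAt) hdet0 i j).fun_mul (h2 j)

/-- The gradient is tested along the line `θ + s a`, on which mean and covariance are affine in `s`.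
-/
lemma inner_score (hμ : IsLinearMap ℝ μ) (hS : IsLinearMap ℝ S)
    (hsymm : ∀ θ, (S θ)ᵀ = S θ) {θ : EuclideanSpace ℝ ι} (hθ : (S θ).PosDef)
    (y : EuclideanSpace ℝ N) (a : EuclideanSpace ℝ ι) :
    inner ℝ a (score μ S θ y) = scoreForm (S θ) (S a) (ofLp (μ a)) (ofLp (y - μ θ)) := by
  have hdiff := differentiableAt_logLik hμ hS hθ y
  have hu : IsUnit (S θ).det := (isUnit_iff_isUnit_det _).1 hθ.isUnit
  have hline : HasDerivAt (fun s : ℝ => θ + s • a) a 0 := by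
    simpa using ((hasDerivAt_id (0 : ℝ)).smul_const a).const_add θ
  have h1 : HasDerivAt (fun s : ℝ => logLik μ S (θ + s • a) y)
      (fderiv ℝ (fun θ' => logLik μ S θ' y) θ a) 0 := by
    have hd : HasFDerivAt (fun θ' => logLik μ S θ' y) (fderiv ℝ (fun θ' => logLik μ S θ' y) θ)
        (θ + (0 : ℝ) • a) := by simpa using hdiff.hasFDerivAt
    exact hd.comp_hasDerivAt (0 : ℝ) hline
  have h2 : inner ℝ a (score μ S θ y) = fderiv ℝ (fun θ' => logLik μ S θ' y) θ a := by
    rw [score, ← toDual_gradient, InnerProductSpace.toDual_apply_apply, real_inner_comm]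
  rw [h2]
  refine h1.unique ?_
  set ε := ofLp (y - μ θ) with hε
  set d := ofLp (μ a) with hd
  have hres (s : ℝ) : ofLp (y - μ (θ + s • a)) = ε - s • d := by
    rw [hμ.map_add, hμ.map_smul, hε, hd]
    ext i; simp; ring
  have hSl (s : ℝ) : S (θ + s • a) = S θ + s • S a := by rw [hS.map_add, hS.map_smul]
  have hf : (fun s : ℝ => logLik μ S (θ + s • a) y) = fun s =>
      -(1 / 2) * (Real.log (S θ + s • S a).det +
        ∑ i, (ε i - s * d i) * ∑ j, (S θ + s • S a)⁻¹ i j * (ε j - s * d j)) := by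
    funext s
    simp only [logLik, hSl, hres, dotProduct, mulVec, Pi.sub_apply, Pi.smul_apply, smul_eq_mul]
  rw [hf]
  have hlog : HasDerivAt (fun s : ℝ => Real.log (S θ + s • S a).det) (((S θ)⁻¹ * S a).trace) 0 := by
    have := (hasDerivAt_det_add_smul (H := S a) hu).log (by simpa using hθ.det_pos.ne')
    simpa [mul_div_cancel_left₀ _ hθ.det_pos.ne'] using this
  have hr (i : N) : HasDerivAt (fun s : ℝ => ε i - s * d i) (-d i) 0 := by
    simpa using ((hasDerivAt_id (0 : ℝ)).mul_const (d i)).const_sub (ε i)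
  have hq := HasDerivAt.fun_sum (u := Finset.univ) fun i _ => (hr i).fun_mul
    (HasDerivAt.fun_sum (u := Finset.univ) fun j _ =>
      (hasDerivAt_inv_add_smul_apply (H := S a) hu i j).fun_mul (hr j))
  have := (hlog.fun_add hq).const_mul (-(1 / 2) : ℝ)
  convert! this using 1
  have hSi : ((S θ)⁻¹)ᵀ = (S θ)⁻¹ := by rw [transpose_nonsing_inv, hsymm]
  have e1 : ∑ i, (-d i * ∑ j, (S θ + (0 : ℝ) • S a)⁻¹ i j * (ε j - 0 * d j) +
      (ε i - 0 * d i) * ∑ j, (-((S θ)⁻¹ * S a * (S θ)⁻¹) i j * (ε j - 0 * d j) +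
        (S θ + (0 : ℝ) • S a)⁻¹ i j * -d j)) =
      -(d ⬝ᵥ ((S θ)⁻¹ *ᵥ ε)) - ε ⬝ᵥ (((S θ)⁻¹ * S a * (S θ)⁻¹) *ᵥ ε) -
        ε ⬝ᵥ ((S θ)⁻¹ *ᵥ d) := by
    simp only [zero_smul, add_zero, zero_mul, sub_zero, dotProduct, mulVec,
      Finset.sum_add_distrib, neg_mul, mul_neg, Finset.sum_neg_distrib, mul_add]
    ring
  rw [e1]
  have e2 : d ⬝ᵥ ((S θ)⁻¹ *ᵥ ε) = ((S θ)⁻¹ *ᵥ d) ⬝ᵥ ε := by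
    rw [dotProduct_mulVec, ← mulVec_transpose, hSi]
  rw [e2, dotProduct_comm ε ((S θ)⁻¹ *ᵥ d), scoreForm]
  ring

end Score

/-! ### The law of the score in a fixed direction -/

section ScoreDistribution

variable {N : Type*} [Fintype N] [DecidableEq N]

lemma sqrt_facts {S : Matrix N N ℝ} (hS : S.PosDef) :
    CFC.sqrt S * CFC.sqrt S = S ∧ (CFC.sqrt S)ᵀ = CFC.sqrt S ∧ IsUnit (CFC.sqrt S).det := by
  have h1 : CFC.sqrt S * CFC.sqrt S = S := CFC.sqrt_mul_sqrt_self _ hS.posSemidef.nonneg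
  refine ⟨h1, transpose_eq_of_posSemidef (CFC.sqrt_nonneg S).posSemidef, ?_⟩
  have hu : IsUnit S.det := (isUnit_iff_isUnit_det _).1 hS.isUnit
  rw [← h1, det_mul] at hu
  exact isUnit_of_mul_isUnit_left hu

/-- In terms of a standard normal vector `w`, the score in a given direction is a centred quadratic
polynomial. -/
lemma exists_scoreForm_sqrt_eq {S H : Matrix N N ℝ} (hS : S.PosDef) (hH : Hᵀ = H) (d : N → ℝ) :
    ∃ (A : Matrix N N ℝ) (b : N → ℝ), Aᵀ = A ∧
      b ⬝ᵥ b = d ⬝ᵥ (S⁻¹ *ᵥ d) ∧ 4 * (A * A).trace = infoForm S H ∧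
      (∀ w, scoreForm S H d (CFC.sqrt S *ᵥ w) = b ⬝ᵥ w + w ⬝ᵥ (A *ᵥ w) - A.trace) ∧
      ∀ s, (∀ x, |x ⬝ᵥ (H *ᵥ x)| ≤ s * (x ⬝ᵥ (S *ᵥ x))) →
        ∀ y, |y ⬝ᵥ (A *ᵥ y)| ≤ s / 2 * (y ⬝ᵥ y) := by
  obtain ⟨hRR, hRt, hRu⟩ := sqrt_facts hS
  set R := CFC.sqrt S
  have hu : IsUnit S.det := (isUnit_iff_isUnit_det _).1 hS.isUnit
  have hSi := transpose_eq_of_posSemidef hS.inv.posSemidef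
  have hSR : S⁻¹ * R = R⁻¹ := by
    rw [← hRR, Matrix.mul_inv_rev, nonsing_inv_mul_cancel_right _ _ hRu]
  have hRS : R * S⁻¹ = R⁻¹ := by
    rw [← hRR, Matrix.mul_inv_rev, mul_nonsing_inv_cancel_left _ _ hRu]
  have hRit : (R⁻¹)ᵀ = R⁻¹ := by rw [transpose_nonsing_inv, hRt]
  have hii : R⁻¹ * R⁻¹ = S⁻¹ := by rw [← Matrix.mul_inv_rev, hRR]
  have hA (w : N → ℝ) : w ⬝ᵥ (((1 / 2 : ℝ) • (R⁻¹ * H * R⁻¹)) *ᵥ w) =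
      1 / 2 * ((R⁻¹ *ᵥ w) ⬝ᵥ (H *ᵥ (R⁻¹ *ᵥ w))) := by
    have := dotProduct_transpose_mul_mul H (R⁻¹) w
    rw [hRit] at this
    rw [smul_mulVec, dotProduct_smul, smul_eq_mul, this]
  -- With residual `ε = R w`, `R = S^{1/2}`, the factor `1/2` in the score goes into `A`; hence the
  -- 4 in the trace identity and the bound `s/2`.
  refine ⟨(1 / 2 : ℝ) • (R⁻¹ * H * R⁻¹), R⁻¹ *ᵥ d, ?_, ?_, ?_, ?_, ?_⟩
  · simp only [transpose_smul, transpose_mul, hRit, hH, Matrix.mul_assoc]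
  · rw [dotProduct_mulVec, ← mulVec_transpose, hRit, mulVec_mulVec, hii, dotProduct_comm]
  · rw [Matrix.smul_mul, Matrix.mul_smul, smul_smul, trace_smul, smul_eq_mul, ← mul_assoc, infoForm]
    norm_num
    calc (R⁻¹ * H * R⁻¹ * (R⁻¹ * H * R⁻¹)).trace = (R⁻¹ * (H * (R⁻¹ * R⁻¹) * H * R⁻¹)).trace := by
          simp only [Matrix.mul_assoc]
      _ = _ := by
          rw [trace_mul_comm, hii]
          simp only [Matrix.mul_assoc]
          rw [hii, trace_mul_comm, ← Matrix.mul_assoc]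
          simp only [Matrix.mul_assoc]
  · intro w
    have e1 : (S⁻¹ *ᵥ d) ⬝ᵥ (R *ᵥ w) = (R⁻¹ *ᵥ d) ⬝ᵥ w := by
      rw [dotProduct_mulVec, ← mulVec_transpose, hRt, mulVec_mulVec, hRS]
    have e2 : (R *ᵥ w) ⬝ᵥ ((S⁻¹ * H * S⁻¹) *ᵥ (R *ᵥ w)) = (R⁻¹ *ᵥ w) ⬝ᵥ (H *ᵥ (R⁻¹ *ᵥ w)) := by
      have := dotProduct_transpose_mul_mul H (S⁻¹) (R *ᵥ w)
      rw [hSi, mulVec_mulVec w (S⁻¹), hSR] at this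
      rw [this]
    have e3 : ((1 / 2 : ℝ) • (R⁻¹ * H * R⁻¹)).trace = 1 / 2 * (S⁻¹ * H).trace := by
      rw [trace_smul, smul_eq_mul, trace_mul_comm, ← Matrix.mul_assoc, hii]
    rw [scoreForm, e1, e2, hA, e3]; ring
  · intro s hs y
    have h1 := hs (R⁻¹ *ᵥ y)
    have h2 : (R⁻¹ *ᵥ y) ⬝ᵥ (S *ᵥ (R⁻¹ *ᵥ y)) = y ⬝ᵥ y := by
      have := dotProduct_transpose_mul_mul S (R⁻¹) y
      rw [← this, hRit, ← hRR, ← Matrix.mul_assoc, nonsing_inv_mul _ hRu, Matrix.one_mul,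
        mul_nonsing_inv _ hRu, one_mulVec]
    rw [h2] at h1
    rw [hA, abs_mul]
    have : |(1 / 2 : ℝ)| = 1 / 2 := by norm_num
    rw [this]; linarith

lemma continuous_scoreForm (S H : Matrix N N ℝ) (d : N → ℝ) (μ : EuclideanSpace ℝ N) :
    Continuous fun y : EuclideanSpace ℝ N => scoreForm S H d (ofLp (y - μ)) := by
  unfold scoreForm
  fun_prop

lemma memLp_two_and_variance_scoreForm {S H : Matrix N N ℝ} (hS : S.PosDef) (hH : Hᵀ = H)
    (d : N → ℝ) (μ : EuclideanSpace ℝ N) :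
    MemLp (fun y => scoreForm S H d (ofLp (y - μ))) 2 (multivariateGaussian μ S) ∧
      Var[fun y => scoreForm S H d (ofLp (y - μ)); multivariateGaussian μ S] =
        d ⬝ᵥ (S⁻¹ *ᵥ d) + 1 / 2 * infoForm S H := by
  obtain ⟨A, b, hA, hb, htr, hw, -⟩ := exists_scoreForm_sqrt_eq hS hH d
  obtain ⟨m1, m2⟩ := memLp_two_and_variance_quadratic_stdGaussian hA b
  have hc := continuous_scoreForm S H d μ
  have hm : AEMeasurable (fun x : EuclideanSpace ℝ N =>
      μ + toEuclideanCLM (𝕜 := ℝ) (CFC.sqrt S) x) (stdGaussian (EuclideanSpace ℝ N)) := by fun_prop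
  have hcomp : (fun y => scoreForm S H d (ofLp (y - μ))) ∘ (fun x : EuclideanSpace ℝ N =>
      μ + toEuclideanCLM (𝕜 := ℝ) (CFC.sqrt S) x) =
      fun w => (b ⬝ᵥ ofLp w + ofLp w ⬝ᵥ (A *ᵥ ofLp w)) - A.trace := by
    funext w
    simp only [Function.comp_apply, add_sub_cancel_left, ofLp_toEuclideanCLM, hw]
  rw [multivariateGaussian]
  constructor
  · rw [memLp_map_measure_iff hc.aestronglyMeasurable hm, hcomp]
    exact m1.sub (memLp_const _)
  · rw [variance_map hc.aemeasurable hm, hcomp, variance_sub_const m1.aestronglyMeasurable, m2, hb,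
      ← htr]
    ring

open Complex in
lemma exists_integral_cexp_scoreForm_eq {S H : Matrix N N ℝ} (hS : S.PosDef) (hH : Hᵀ = H)
    (d : N → ℝ) (μ : EuclideanSpace ℝ N) (hvar : d ⬝ᵥ (S⁻¹ *ᵥ d) + 1 / 2 * infoForm S H = 1)
    {s : ℝ} (hs : ∀ x, |x ⬝ᵥ (H *ᵥ x)| ≤ s * (x ⬝ᵥ (S *ᵥ x))) {t : ℝ} (ht : |t| * s ≤ 1 / 2) :
    ∃ η : ℂ, ‖η‖ ≤ |t| ^ 3 * s ∧
      ∫ y, cexp ((t * scoreForm S H d (ofLp (y - μ)) : ℝ) * I) ∂(multivariateGaussian μ S) =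
        cexp (-(t ^ 2 / 2) + η) := by
  obtain ⟨A, b, hA, hb, htr, hw, hsA⟩ := exists_scoreForm_sqrt_eq hS hH d
  obtain ⟨η, h1, h2⟩ := exists_charFun_quadratic_stdGaussian_eq hA b
    (by rw [hb, ← hvar, ← htr]; ring) (hsA s hs) (t := t) (by linarith)
  refine ⟨η, by linarith, ?_⟩
  have hc := continuous_scoreForm S H d μ
  rw [multivariateGaussian, integral_map (by fun_prop)
    (Continuous.aestronglyMeasurable (by fun_prop))]
  simp only [add_sub_cancel_left, ofLp_toEuclideanCLM, hw]
  exact h2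

end ScoreDistribution

/-! ### Fisher information and the standardized score -/

section Information

variable {N ι : Type*} [Fintype N] [DecidableEq N] [Fintype ι] [DecidableEq ι]
variable {μ : EuclideanSpace ℝ ι → EuclideanSpace ℝ N} {S : EuclideanSpace ℝ ι → Matrix N N ℝ}

lemma fisherInfo_transpose (θ : EuclideanSpace ℝ ι) :
    (fisherInfo μ S θ)ᵀ = fisherInfo μ S θ := by
  ext i j
  simp only [fisherInfo, transpose_apply, of_apply]
  exact covariance_comm _ _

/-- The Fisher information of a Gaussian family with linear mean and covariance. -/
lemma dotProduct_fisherInfo_mulVec (hμ : IsLinearMap ℝ μ) (hS : IsLinearMap ℝ S)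
    (hsymm : ∀ θ, (S θ)ᵀ = S θ) {θ : EuclideanSpace ℝ ι} (hθ : (S θ).PosDef)
    (a : EuclideanSpace ℝ ι) :
    ofLp a ⬝ᵥ (fisherInfo μ S θ *ᵥ ofLp a) =
      ofLp (μ a) ⬝ᵥ ((S θ)⁻¹ *ᵥ ofLp (μ a)) + 1 / 2 * infoForm (S θ) (S a) := by
  have hcoord (i : ι) (y : EuclideanSpace ℝ N) : score μ S θ y i =
      scoreForm (S θ) (S (EuclideanSpace.single i 1)) (ofLp (μ (EuclideanSpace.single i 1)))
        (ofLp (y - μ θ)) := by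
    rw [← inner_score hμ hS hsymm hθ, EuclideanSpace.inner_single_left]; simp
  have hmem (i : ι) : MemLp (fun y => score μ S θ y i) 2 (multivariateGaussian (μ θ) (S θ)) := by
    simp only [hcoord]
    exact (memLp_two_and_variance_scoreForm hθ (hsymm _) _ _).1
  rw [← (memLp_two_and_variance_scoreForm hθ (hsymm a) (ofLp (μ a)) (μ θ)).2]
  simp only [← inner_score hμ hS hsymm hθ]
  -- The quadratic form of the covariance matrix at `a` is the variance of the score paired with
  -- `a`.
  have hsum : (fun y => inner ℝ a (score μ S θ y)) = fun y => ∑ i, a i * score μ S θ y i := by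
    funext y
    rw [PiLp.inner_apply]
    refine Finset.sum_congr rfl fun i _ => ?_
    simp [mul_comm]
  rw [hsum, variance_fun_sum fun i => (hmem i).const_mul (a i)]
  simp only [covariance_const_mul_left, covariance_const_mul_right, dotProduct, mulVec,
    fisherInfo, of_apply, Finset.mul_sum]
  exact Finset.sum_congr rfl fun i _ => Finset.sum_congr rfl fun j _ => by ring

lemma posDef_fisherInfo (hμ : IsLinearMap ℝ μ) (hS : IsLinearMap ℝ S)
    (hsymm : ∀ θ, (S θ)ᵀ = S θ) {θ : EuclideanSpace ℝ ι} (hθ : (S θ).PosDef)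
    (h : ∀ a, μ a = 0 → infoForm (S θ) (S a) = 0 → a = 0) : (fisherInfo μ S θ).PosDef := by
  rw [posDef_real_iff]
  refine ⟨fisherInfo_transpose θ, fun x hx => ?_⟩
  have e := dotProduct_fisherInfo_mulVec hμ hS hsymm hθ (toLp 2 x)
  rw [ofLp_toLp] at e
  rw [e]
  have h1 := infoForm_nonneg hθ (hsymm (toLp 2 x))
  have h2 := (posSemidef_real_iff.1 hθ.inv.posSemidef).2 (ofLp (μ (toLp 2 x)))
  by_cases hz : μ (toLp 2 x) = 0
  · have : infoForm (S θ) (S (toLp 2 x)) ≠ 0 := fun h0 => hx (by simpa using h _ hz h0)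
    have := lt_of_le_of_ne h1 this.symm
    linarith
  · have := (posDef_real_iff.1 hθ.inv).2 (ofLp (μ (toLp 2 x))) (by simpa using hz)
    linarith

/-- Take `a = I^{-1/2} u` and move the symmetric factor across the inner product; `aᵀ I a = ‖u‖² =
1`. -/
lemma exists_inner_stdScore_eq (hμ : IsLinearMap ℝ μ) (hS : IsLinearMap ℝ S)
    (hsymm : ∀ θ, (S θ)ᵀ = S θ) {θ : EuclideanSpace ℝ ι} (hθ : (S θ).PosDef)
    (hI : (fisherInfo μ S θ).PosDef) {u : EuclideanSpace ℝ ι} (hu : ‖u‖ = 1) :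
    ∃ a : EuclideanSpace ℝ ι,
      ofLp (μ a) ⬝ᵥ ((S θ)⁻¹ *ᵥ ofLp (μ a)) + 1 / 2 * infoForm (S θ) (S a) = 1 ∧
      ∀ y, inner ℝ u (stdScore μ S θ y) =
        scoreForm (S θ) (S a) (ofLp (μ a)) (ofLp (y - μ θ)) := by
  obtain ⟨hRR, hRt, hRu⟩ := sqrt_facts hI
  set R := CFC.sqrt (fisherInfo μ S θ) with hR
  have hRit : (R⁻¹)ᵀ = R⁻¹ := by rw [transpose_nonsing_inv, hRt]
  refine ⟨toLp 2 (R⁻¹ *ᵥ ofLp u), ?_, fun y => ?_⟩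
  · have h1 := dotProduct_transpose_mul_mul (fisherInfo μ S θ) (R⁻¹) (ofLp u)
    rw [← dotProduct_fisherInfo_mulVec hμ hS hsymm hθ, ofLp_toLp, ← h1, hRit, ← hRR,
      ← Matrix.mul_assoc, nonsing_inv_mul _ hRu, Matrix.one_mul, mul_nonsing_inv _ hRu, one_mulVec,
      ofLp_dotProduct_ofLp, real_inner_self_eq_norm_sq, hu, one_pow]
  · rw [← inner_score hμ hS hsymm hθ, stdScore, ← hR, ← ofLp_dotProduct_ofLp, ← ofLp_dotProduct_ofLp,
      ofLp_toLp, ofLp_toLp, dotProduct_comm, dotProduct_mulVec, ← mulVec_transpose, hRit,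
      dotProduct_comm]

/-- Invertibility of the information is not assumed, so measurability is available also for those
`m` where the restricted information might be singular. -/
lemma continuous_inner_stdScore (hμ : IsLinearMap ℝ μ) (hS : IsLinearMap ℝ S)
    (hsymm : ∀ θ, (S θ)ᵀ = S θ) {θ : EuclideanSpace ℝ ι} (hθ : (S θ).PosDef)
    (u : EuclideanSpace ℝ ι) : Continuous fun y => inner ℝ u (stdScore μ S θ y) := by
  set R := CFC.sqrt (fisherInfo μ S θ) with hR
  have h : (fun y => inner ℝ u (stdScore μ S θ y)) = fun y =>
      scoreForm (S θ) (S (toLp 2 ((R⁻¹)ᵀ *ᵥ ofLp u)))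
        (ofLp (μ (toLp 2 ((R⁻¹)ᵀ *ᵥ ofLp u)))) (ofLp (y - μ θ)) := by
    funext y
    rw [← inner_score hμ hS hsymm hθ, stdScore, ← hR, ← ofLp_dotProduct_ofLp, ← ofLp_dotProduct_ofLp,
      ofLp_toLp, ofLp_toLp, dotProduct_comm, dotProduct_mulVec, ← mulVec_transpose, dotProduct_comm]
  rw [h]
  exact continuous_scoreForm _ _ _ _

end Information

/-! ### Gaussian laws of images, sums and stacked vectors -/

section Laws

variable {Ω : Type*} [MeasurableSpace Ω] {P : Measure Ω} [IsProbabilityMeasure P]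
variable {N K : Type*} [Fintype N] [DecidableEq N] [Fintype K] [DecidableEq K]

lemma hasLaw_mulVec_multivariateGaussian {W : Ω → EuclideanSpace ℝ N} {μ : EuclideanSpace ℝ N}
    {S : Matrix N N ℝ} (hS : S.PosSemidef) (hW : HasLaw W (multivariateGaussian μ S) P)
    (B : Matrix K N ℝ) :
    HasLaw (fun ω => toLp 2 (B *ᵥ ofLp (W ω)))
      (multivariateGaussian (toLp 2 (B *ᵥ ofLp μ)) (B * S * Bᵀ)) P := by
  have hm : Measurable fun x : EuclideanSpace ℝ N => toLp 2 (B *ᵥ ofLp x) :=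
    Continuous.measurable (by fun_prop)
  have hlaw : (multivariateGaussian μ S).map (fun x => toLp 2 (B *ᵥ ofLp x)) =
      multivariateGaussian (toLp 2 (B *ᵥ ofLp μ)) (B * S * Bᵀ) := by
    have : IsProbabilityMeasure
        ((multivariateGaussian μ S).map (fun x => toLp 2 (B *ᵥ ofLp x))) :=
      Measure.isProbabilityMeasure_map hm.aemeasurable
    apply Measure.ext_of_charFun
    funext t
    have hin (x : EuclideanSpace ℝ N) : inner ℝ (toLp 2 (B *ᵥ ofLp x)) t =
        inner ℝ x (toLp 2 (Bᵀ *ᵥ ofLp t)) := by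
      rw [← ofLp_dotProduct_ofLp, ← ofLp_dotProduct_ofLp, ofLp_toLp, ofLp_toLp, dotProduct_mulVec,
        mulVec_transpose]
    rw [charFun_apply, integral_map hm.aemeasurable
      (Continuous.aestronglyMeasurable (by fun_prop))]
    simp_rw [hin]
    rw [← charFun_apply, charFun_multivariateGaussian hS,
      charFun_multivariateGaussian (posSemidef_mul_mul_transpose hS B), real_inner_comm, ← hin,
      real_inner_comm]
    have := dotProduct_transpose_mul_mul S Bᵀ (ofLp t)
    rw [transpose_transpose] at this
    rw [this]
  have hL : HasLaw (fun x : EuclideanSpace ℝ N => toLp 2 (B *ᵥ ofLp x))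
      (multivariateGaussian (toLp 2 (B *ᵥ ofLp μ)) (B * S * Bᵀ)) (multivariateGaussian μ S) :=
    ⟨hm.aemeasurable, hlaw⟩
  exact hL.comp hW

lemma hasLaw_const_add_multivariateGaussian {W : Ω → EuclideanSpace ℝ N} {μ : EuclideanSpace ℝ N}
    {S : Matrix N N ℝ} (hW : HasLaw W (multivariateGaussian μ S) P)
    (c : EuclideanSpace ℝ N) :
    HasLaw (fun ω => c + W ω) (multivariateGaussian (c + μ) S) P := by
  have hm : Measurable fun x : EuclideanSpace ℝ N => c + x := by fun_prop
  have hlaw : (multivariateGaussian μ S).map (fun x => c + x) =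
      multivariateGaussian (c + μ) S := by
    have : (fun x => c + μ + toEuclideanCLM (𝕜 := ℝ) (CFC.sqrt S) x) =
        (fun x => c + x) ∘ fun x => μ + toEuclideanCLM (𝕜 := ℝ) (CFC.sqrt S) x := by
      funext x; simp [add_assoc]
    rw [multivariateGaussian, multivariateGaussian, this, Measure.map_map hm (by fun_prop)]
  have hL : HasLaw (fun x : EuclideanSpace ℝ N => c + x) (multivariateGaussian (c + μ) S)
      (multivariateGaussian μ S) := ⟨hm.aemeasurable, hlaw⟩
  exact hL.comp hW

lemma hasLaw_add_multivariateGaussian {W₁ W₂ : Ω → EuclideanSpace ℝ N}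
    {μ₁ μ₂ : EuclideanSpace ℝ N} {S₁ S₂ : Matrix N N ℝ} (hS₁ : S₁.PosSemidef) (hS₂ : S₂.PosSemidef)
    (h₁ : HasLaw W₁ (multivariateGaussian μ₁ S₁) P) (h₂ : HasLaw W₂ (multivariateGaussian μ₂ S₂) P)
    (hind : IndepFun W₁ W₂ P) :
    HasLaw (fun ω => W₁ ω + W₂ ω) (multivariateGaussian (μ₁ + μ₂) (S₁ + S₂)) P := by
  refine ⟨h₁.aemeasurable.add h₂.aemeasurable, ?_⟩
  have : IsProbabilityMeasure (P.map fun ω => W₁ ω + W₂ ω) :=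
    Measure.isProbabilityMeasure_map (h₁.aemeasurable.add h₂.aemeasurable)
  apply Measure.ext_of_charFun
  funext t
  rw [hind.charFun_map_fun_add_eq_mul h₁.aemeasurable h₂.aemeasurable, Pi.mul_apply, h₁.map_eq,
    h₂.map_eq, charFun_multivariateGaussian hS₁, charFun_multivariateGaussian hS₂,
    charFun_multivariateGaussian (hS₁.add hS₂), ← Complex.exp_add, inner_add_right, add_mulVec,
    dotProduct_add]
  congr 1
  push_cast
  ring

variable {m q p : ℕ} {n : Fin m → ℕ}

lemma hasLaw_stackY {Y : (i : Fin m) → Ω → EuclideanSpace ℝ (Fin (n i))}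
    {μ : (i : Fin m) → EuclideanSpace ℝ (Fin (n i))}
    {S : (i : Fin m) → Matrix (Fin (n i)) (Fin (n i)) ℝ} (hS : ∀ i, (S i).PosSemidef)
    (hY : ∀ i, HasLaw (Y i) (multivariateGaussian (μ i) (S i)) P) (hind : iIndepFun Y P) :
    HasLaw (fun ω => stackY fun i => Y i ω)
      (multivariateGaussian (stackY μ) (blockDiagonal' S)) P := by
  have hmeas : AEMeasurable (fun ω => stackY fun i => Y i ω) P := by
    have h (i : Fin m) := (hY i).aemeasurable
    have : AEMeasurable (fun ω => fun k : ObsIdx n => Y k.1 ω k.2) P :=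
      aemeasurable_pi_lambda _ fun k =>
        (Continuous.measurable (by fun_prop :
          Continuous fun x : EuclideanSpace ℝ (Fin (n k.1)) => x k.2)).comp_aemeasurable (h k.1)
    exact (Continuous.measurable (by fun_prop : Continuous
      fun x : ObsIdx n → ℝ => toLp 2 x)).comp_aemeasurable this
  refine ⟨hmeas, ?_⟩
  have : IsProbabilityMeasure (P.map fun ω => stackY fun i => Y i ω) :=
    Measure.isProbabilityMeasure_map hmeas
  apply Measure.ext_of_charFun
  funext t
  set τ : (i : Fin m) → EuclideanSpace ℝ (Fin (n i)) := fun i => toLp 2 fun j => t ⟨i, j⟩ with hτ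
  have hin (y : (i : Fin m) → EuclideanSpace ℝ (Fin (n i))) :
      inner ℝ (stackY y) t = ∑ i, inner ℝ (y i) (τ i) := by
    simp only [PiLp.inner_apply, Fintype.sum_sigma]
    rfl
  have hXm (i : Fin m) : Measurable fun x : EuclideanSpace ℝ (Fin (n i)) => inner ℝ x (τ i) :=
    Continuous.measurable (by fun_prop)
  have hX (i : Fin m) : AEMeasurable (fun ω => inner ℝ (Y i ω) (τ i)) P :=
    (hXm i).comp_aemeasurable (hY i).aemeasurable
  have hXind : iIndepFun (fun i ω => inner ℝ (Y i ω) (τ i)) P := hind.comp _ hXm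
  have hone (i : Fin m) : charFun (P.map fun ω => inner ℝ (Y i ω) (τ i)) 1 =
      charFun (multivariateGaussian (μ i) (S i)) (τ i) := by
    rw [charFun_apply_real, integral_map (hX i) (Continuous.aestronglyMeasurable (by fun_prop)),
      ← (hY i).map_eq, charFun_apply, integral_map (hY i).aemeasurable
        (Continuous.aestronglyMeasurable (by fun_prop))]
    simp
  -- The stacked characteristic function at `t` is that of a sum of independent real variables at 1,
  -- hence a product.
  have h1 : charFun (P.map fun ω => stackY fun i => Y i ω) t =
      charFun (P.map fun ω => ∑ i, inner ℝ (Y i ω) (τ i)) 1 := by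
    rw [charFun_apply, integral_map hmeas (Continuous.aestronglyMeasurable (by fun_prop)),
      charFun_apply_real, integral_map (Finset.aemeasurable_fun_sum _ fun i _ => hX i)
        (Continuous.aestronglyMeasurable (by fun_prop))]
    simp_rw [hin]
    simp
  rw [h1, hXind.charFun_map_fun_sum_eq_prod hX, Finset.prod_apply]
  simp_rw [hone, charFun_multivariateGaussian (hS _)]
  rw [charFun_multivariateGaussian (posSemidef_blockDiagonal' hS), ← Complex.exp_sum,
    dotProduct_blockDiagonal'_mulVec, real_inner_comm, hin]
  congr 1
  push_cast
  rw [Finset.sum_sub_distrib, Finset.sum_mul, Finset.sum_div]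
  congr 1
  exact Finset.sum_congr rfl fun i _ => by rw [real_inner_comm]

lemma Sig_eq_blockDiagonal' (Z : (i : Fin m) → Matrix (Fin (n i)) (Fin q) ℝ)
    (ψ : EuclideanSpace ℝ (VarIdx q)) :
    Sig Z ψ = blockDiagonal' fun i => Z i * Psi1 ψ * (Z i)ᵀ + errVar ψ • 1 := by
  have h1 : (errVar ψ • 1 : Matrix (ObsIdx n) (ObsIdx n) ℝ) =
      blockDiagonal' fun _ => errVar ψ • 1 := by
    rw [← blockDiagonal'_one, ← blockDiagonal'_smul]; rfl
  rw [Sig, blockZ, Psi, blockDiagonal'_transpose, ← blockDiagonal'_mul, ← blockDiagonal'_mul, h1,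
    ← blockDiagonal'_add]
  rfl

lemma psiPart_joinParam (β : EuclideanSpace ℝ (Fin p)) (ψ : EuclideanSpace ℝ (VarIdx q)) :
    psiPart (joinParam β ψ) = ψ := by
  ext k; simp [psiPart, joinParam]

/-- In the clustered model, `Y ∼ N(X β, Σ(ψ))`. -/
theorem IsClusterModel.hasLaw_stackY {X : (i : Fin m) → Matrix (Fin (n i)) (Fin p) ℝ}
    {Z : (i : Fin m) → Matrix (Fin (n i)) (Fin q) ℝ} {β : EuclideanSpace ℝ (Fin p)}
    {ψ : EuclideanSpace ℝ (VarIdx q)} (hψ : ψ ∈ paramSet q)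
    {Y : (i : Fin m) → Ω → EuclideanSpace ℝ (Fin (n i))} (h : IsClusterModel P X Z β ψ Y) :
    HasLaw (fun ω => stackY fun i => Y i ω)
      (multivariateGaussian (meanY X (joinParam β ψ)) (Sig Z ψ)) P := by
  obtain ⟨U, E, hU, hE, hUE, hind, hYe⟩ := h
  have hI (i : Fin m) : (errVar ψ • (1 : Matrix (Fin (n i)) (Fin (n i)) ℝ)).PosSemidef :=
    PosSemidef.one.smul hψ.2.le
  have hZ (i : Fin m) : (Z i * Psi1 ψ * (Z i)ᵀ).PosSemidef := posSemidef_mul_mul_transpose hψ.1 _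
  have hmap (i : Fin m) : Measurable fun x : EuclideanSpace ℝ (Fin q) =>
      toLp 2 (Z i *ᵥ ofLp x) := Continuous.measurable (by fun_prop)
  have hYe' (i : Fin m) : Y i = fun ω => toLp 2 (X i *ᵥ ofLp β) +
      (toLp 2 (Z i *ᵥ ofLp (U i ω)) + E i ω) := by
    funext ω; rw [hYe i ω]; ext j; simp [add_assoc]
  have hlaw (i : Fin m) : HasLaw (Y i) (multivariateGaussian (toLp 2 (X i *ᵥ ofLp β))
      (Z i * Psi1 ψ * (Z i)ᵀ + errVar ψ • 1)) P := by
    have h1 := hasLaw_mulVec_multivariateGaussian hψ.1 (hU i) (Z i)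
    have h2 := hasLaw_add_multivariateGaussian (hZ i) (hI i) h1 (hE i)
      ((hUE i).comp (hmap i) measurable_id)
    have h3 := hasLaw_const_add_multivariateGaussian h2
      (toLp 2 (X i *ᵥ ofLp β))
    rw [hYe' i]
    simpa using h3
  have hYind : iIndepFun Y P := by
    have := hind.comp (fun i (x : EuclideanSpace ℝ (Fin q) × EuclideanSpace ℝ (Fin (n i))) =>
      toLp 2 (X i *ᵥ ofLp β) + (toLp 2 (Z i *ᵥ ofLp x.1) + x.2)) fun i =>
        Continuous.measurable (by fun_prop)
    have e : Y = fun i => (fun x : EuclideanSpace ℝ (Fin q) × EuclideanSpace ℝ (Fin (n i)) =>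
      toLp 2 (X i *ᵥ ofLp β) + (toLp 2 (Z i *ᵥ ofLp x.1) + x.2)) ∘ fun ω => (U i ω, E i ω) :=
      funext hYe'
    rw [e]; exact this
  have := LMM.hasLaw_stackY (fun i => (hZ i).add (hI i)) hlaw hYind
  rw [← Sig_eq_blockDiagonal'] at this
  exact this

end Laws

/-! ### Linearity in the parameter -/

section Linearity

variable {m p q : ℕ} {n : Fin m → ℕ}

lemma isLinearMap_Sig (Z : (i : Fin m) → Matrix (Fin (n i)) (Fin q) ℝ) :
    IsLinearMap ℝ (Sig Z) := by
  have hadd (a b : EuclideanSpace ℝ (VarIdx q)) : Psi m (a + b) = Psi m a + Psi m b := by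
    rw [Psi, Psi, Psi, ← blockDiagonal'_add]; rfl
  have hsmul (c : ℝ) (a : EuclideanSpace ℝ (VarIdx q)) : Psi m (c • a) = c • Psi m a := by
    rw [Psi, Psi, ← blockDiagonal'_smul]; rfl
  constructor
  · intro a b
    have : errVar (a + b) = errVar a + errVar b := rfl
    rw [Sig, Sig, Sig, hadd, this, Matrix.mul_add, Matrix.add_mul, add_smul]
    abel
  · intro c a
    have : errVar (c • a) = c * errVar a := rfl
    rw [Sig, Sig, hsmul, this, Matrix.mul_smul, Matrix.smul_mul, mul_smul, smul_add]

lemma isLinearMap_Sig_psiPart (Z : (i : Fin m) → Matrix (Fin (n i)) (Fin q) ℝ) :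
    IsLinearMap ℝ fun θ : EuclideanSpace ℝ (Fin p ⊕ VarIdx q) => Sig Z (psiPart θ) :=
  ⟨fun a b => (isLinearMap_Sig Z).map_add (psiPart a) (psiPart b),
    fun c a => (isLinearMap_Sig Z).map_smul c (psiPart a)⟩

lemma isLinearMap_meanY (X : (i : Fin m) → Matrix (Fin (n i)) (Fin p) ℝ) :
    IsLinearMap ℝ fun θ : EuclideanSpace ℝ (Fin p ⊕ VarIdx q) => meanY X θ := by
  constructor
  · intro a b
    have : ofLp (betaPart (a + b)) = ofLp (betaPart a) + ofLp (betaPart b) := rfl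
    rw [meanY, this, mulVec_add]; rfl
  · intro c a
    have : ofLp (betaPart (c • a)) = c • ofLp (betaPart a) := rfl
    rw [meanY, this, mulVec_smul]; rfl

lemma eq_zero_of_mulVec_eq_zero_of_rank {N : Type*} [Fintype N] {A : Matrix N (Fin p) ℝ}
    (hA : A.rank = p) {x : Fin p → ℝ} (hx : A *ᵥ x = 0) : x = 0 := by
  have h := LinearMap.finrank_range_add_finrank_ker A.mulVecLin
  rw [← Matrix.rank, hA, Module.finrank_fin_fun, Nat.add_eq_left, Submodule.finrank_eq_zero] at h
  have : x ∈ LinearMap.ker A.mulVecLin := by simpa using hx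
  rw [h] at this
  simpa using this

variable {K : Type*} [Fintype K] [DecidableEq K]

/-- `Vᵀ V = 1` carries the error part to a multiple of the identity, making the restricted model a
compression of the full one. -/
lemma SigR_eq {V : Matrix (ObsIdx n) K ℝ} (hV : Vᵀ * V = 1)
    (Z : (i : Fin m) → Matrix (Fin (n i)) (Fin q) ℝ) (ψ : EuclideanSpace ℝ (VarIdx q)) :
    SigR V Z ψ = Vᵀ * Sig Z ψ * V := by
  rw [SigR, Sig, Matrix.mul_add, Matrix.add_mul, Matrix.mul_smul, Matrix.mul_one, Matrix.smul_mul,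
    hV, transpose_mul, transpose_transpose]
  simp only [Matrix.mul_assoc]

lemma isLinearMap_SigR {V : Matrix (ObsIdx n) K ℝ} (hV : Vᵀ * V = 1)
    (Z : (i : Fin m) → Matrix (Fin (n i)) (Fin q) ℝ) : IsLinearMap ℝ (SigR V Z) := by
  constructor
  · intro a b
    rw [SigR_eq hV, SigR_eq hV, SigR_eq hV, (isLinearMap_Sig Z).map_add, Matrix.mul_add,
      Matrix.add_mul]
  · intro c a
    rw [SigR_eq hV, SigR_eq hV, (isLinearMap_Sig Z).map_smul, Matrix.mul_smul, Matrix.smul_mul]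

lemma SigR_transpose {V : Matrix (ObsIdx n) K ℝ} (hV : Vᵀ * V = 1)
    (Z : (i : Fin m) → Matrix (Fin (n i)) (Fin q) ℝ) (ψ : EuclideanSpace ℝ (VarIdx q)) :
    (SigR V Z ψ)ᵀ = SigR V Z ψ := by
  rw [SigR_eq hV]
  simp only [transpose_mul, transpose_transpose, Sig_transpose, Matrix.mul_assoc]

lemma posDef_SigR {V : Matrix (ObsIdx n) K ℝ} (hV : Vᵀ * V = 1)
    (Z : (i : Fin m) → Matrix (Fin (n i)) (Fin q) ℝ) {ψ : EuclideanSpace ℝ (VarIdx q)}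
    (hψ : ψ ∈ paramSet q) : (SigR V Z ψ).PosDef := by
  rw [SigR_eq hV]; exact posDef_transpose_mul_mul (posDef_Sig Z hψ) hV

end Linearity

/-! ### The clustered model: information and characteristic functions -/

section Clusters

variable {m p q : ℕ} {n : Fin m → ℕ}

/-- The structural assumptions on one model of the sequence. -/
structure IsRegularModel (Z : (i : Fin m) → Matrix (Fin (n i)) (Fin q) ℝ)
    (ψ : EuclideanSpace ℝ (VarIdx q)) (c₁ c₂ : ℝ) : Prop where
  hm : 1 ≤ m
  hq : 1 ≤ q
  hψ : ψ ∈ paramSet q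
  hc₁ : 1 < c₁
  hc₂ : 1 < c₂
  h_i : c₁ ≤ ((∑ i, (n i : ℝ)) / m) / q
  h_ii : ∀ i, ∀ γ ∈ spectrum ℝ ((Z i)ᵀ * Z i), c₂⁻¹ ≤ γ ∧ γ ≤ c₂

variable {Z : (i : Fin m) → Matrix (Fin (n i)) (Fin q) ℝ} {ψ : EuclideanSpace ℝ (VarIdx q)}
  {c₁ c₂ : ℝ}

lemma clusterConst_pos (hc₁ : 1 < c₁) (hc₂ : 1 < c₂) : 0 < clusterConst c₁ c₂ := by
  have : 0 < c₁ - 1 := by linarith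
  unfold clusterConst
  positivity

lemma IsRegularModel.eq_zero (h : IsRegularModel Z ψ c₁ c₂) {a : EuclideanSpace ℝ (VarIdx q)}
    (ha : infoForm (Sig Z ψ) (Sig Z a) = 0) : a = 0 :=
  (Sig_direction_bound h.hm h.hq Z h.hψ h.hc₁ h.hc₂ h.h_i h.h_ii a).1 ha

lemma IsRegularModel.abs_le (h : IsRegularModel Z ψ c₁ c₂) (a : EuclideanSpace ℝ (VarIdx q))
    (x : ObsIdx n → ℝ) :
    |x ⬝ᵥ (Sig Z a *ᵥ x)| ≤
      √(clusterConst c₁ c₂ * infoForm (Sig Z ψ) (Sig Z a) / m) * (x ⬝ᵥ (Sig Z ψ *ᵥ x)) := by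
  obtain ⟨-, s, hs0, hs, hms⟩ :=
    Sig_direction_bound h.hm h.hq Z h.hψ h.hc₁ h.hc₂ h.h_i h.h_ii a
  have hm0 : (0 : ℝ) < m := by exact_mod_cast h.hm
  refine (hs x).trans (mul_le_mul_of_nonneg_right ?_
    ((posSemidef_real_iff.1 (posDef_Sig Z h.hψ).posSemidef).2 x))
  apply Real.le_sqrt_of_sq_le
  rw [le_div_iff₀ hm0]; linarith

/-- When `p / m` is small, restricting to `Vᵀ Y` loses at most half of the information. -/
lemma IsRegularModel.infoForm_le_SigR {p : ℕ} {K : Type*} [Fintype K] [DecidableEq K]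
    (h : IsRegularModel Z ψ c₁ c₂)
    {V : Matrix (ObsIdx n) K ℝ} (hV : Vᵀ * V = 1)
    (hcard : (Fintype.card (ObsIdx n) : ℝ) - Fintype.card K = p)
    (hp : (p : ℝ) / m * (4 * clusterConst c₁ c₂) ≤ 1) (a : EuclideanSpace ℝ (VarIdx q)) :
    infoForm (Sig Z ψ) (Sig Z a) ≤ 2 * infoForm (SigR V Z ψ) (SigR V Z a) := by
  have hF0 := infoForm_nonneg (posDef_Sig Z h.hψ) (Sig_transpose Z a)
  -- The compression bound needs `s > 0`, so zero information is treated apart.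
  rcases hF0.eq_or_lt with h0 | hF
  · rw [← h0]
    exact mul_nonneg (by norm_num) (infoForm_nonneg (posDef_SigR hV Z h.hψ) (SigR_transpose hV Z a))
  · have hm0 : (0 : ℝ) < m := by exact_mod_cast h.hm
    have hC := clusterConst_pos h.hc₁ h.hc₂
    have key := infoForm_compression_ge (posDef_Sig Z h.hψ) (Sig_transpose Z a)
      (Real.sqrt_pos.2 (by positivity)) (h.abs_le a) hV
    rw [hcard, Real.sq_sqrt (by positivity), ← SigR_eq hV, ← SigR_eq hV] at key
    -- The loss `2 p s²` with `s² = C F / m` is at most `F / 2` by `hp`.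
    have e : 2 * (p : ℝ) * (clusterConst c₁ c₂ * infoForm (Sig Z ψ) (Sig Z a) / m) =
        ((p : ℝ) / m * (4 * clusterConst c₁ c₂)) * (infoForm (Sig Z ψ) (Sig Z a) / 2) := by
      field_simp; ring
    rw [e] at key
    have := mul_le_mul_of_nonneg_right hp (by positivity : 0 ≤ infoForm (Sig Z ψ) (Sig Z a) / 2)
    linarith

lemma IsRegularModel.abs_SigR_le {K : Type*} [Fintype K] [DecidableEq K]
    (h : IsRegularModel Z ψ c₁ c₂) {V : Matrix (ObsIdx n) K ℝ} (hV : Vᵀ * V = 1)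
    (a : EuclideanSpace ℝ (VarIdx q)) (x : K → ℝ) :
    |x ⬝ᵥ (SigR V Z a *ᵥ x)| ≤
      √(clusterConst c₁ c₂ * infoForm (Sig Z ψ) (Sig Z a) / m) * (x ⬝ᵥ (SigR V Z ψ *ᵥ x)) := by
  rw [SigR_eq hV, SigR_eq hV, dotProduct_transpose_mul_mul, dotProduct_transpose_mul_mul]
  exact h.abs_le a _

lemma IsRegularModel.posDef_info (h : IsRegularModel Z ψ c₁ c₂)
    {X : (i : Fin m) → Matrix (Fin (n i)) (Fin p) ℝ} (hX : (stackX X).rank = p)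
    (β : EuclideanSpace ℝ (Fin p)) : (info X Z (joinParam β ψ)).PosDef := by
  refine posDef_fisherInfo (isLinearMap_meanY X) (isLinearMap_Sig_psiPart Z)
    (fun θ => Sig_transpose Z _) (by rw [psiPart_joinParam]; exact posDef_Sig Z h.hψ) ?_
  intro a h1 h2
  rw [psiPart_joinParam] at h2
  have h3 := h.eq_zero h2
  have h4 : ofLp (betaPart a) = 0 := by
    refine eq_zero_of_mulVec_eq_zero_of_rank hX ?_
    simpa [meanY] using h1
  ext k
  rcases k with k | k
  · exact congrFun h4 k
  · exact congrFun (congrArg ofLp h3) k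

lemma IsRegularModel.posDef_infoR {K : Type*} [Fintype K] [DecidableEq K]
    (h : IsRegularModel Z ψ c₁ c₂) {V : Matrix (ObsIdx n) K ℝ} (hV : Vᵀ * V = 1)
    (hle : ∀ a, infoForm (Sig Z ψ) (Sig Z a) ≤ 2 * infoForm (SigR V Z ψ) (SigR V Z a)) :
    (infoR V Z ψ).PosDef := by
  refine posDef_fisherInfo ⟨fun _ _ => by simp, fun _ _ => by simp⟩ (isLinearMap_SigR hV Z)
    (SigR_transpose hV Z) (posDef_SigR hV Z h.hψ) fun a _ ha => h.eq_zero ?_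
  have h1 := hle a
  rw [ha, mul_zero] at h1
  exact le_antisymm h1 (infoForm_nonneg (posDef_Sig Z h.hψ) (Sig_transpose Z a))

variable {Ω : Type*} [MeasurableSpace Ω] {P : Measure Ω} [IsProbabilityMeasure P]

open Complex in
lemma IsRegularModel.exists_integral_cexp_WS_eq (h : IsRegularModel Z ψ c₁ c₂)
    {X : (i : Fin m) → Matrix (Fin (n i)) (Fin p) ℝ} (hX : (stackX X).rank = p)
    {β : EuclideanSpace ℝ (Fin p)} {Y : (i : Fin m) → Ω → EuclideanSpace ℝ (Fin (n i))}
    (hY : IsClusterModel P X Z β ψ Y) {u : EuclideanSpace ℝ (Fin p ⊕ VarIdx q)} (hu : ‖u‖ = 1)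
    {t : ℝ} (ht : |t| * √(4 * clusterConst c₁ c₂ / m) ≤ 1 / 2) :
    ∃ η : ℂ, ‖η‖ ≤ |t| ^ 3 * √(4 * clusterConst c₁ c₂ / m) ∧
      ∫ ω, cexp ((t * inner ℝ u (WS X Z (joinParam β ψ) (stackY fun i => Y i ω)) : ℝ) * I) ∂P =
        cexp (-(t ^ 2 / 2) + η) := by
  have hlaw := hY.hasLaw_stackY h.hψ
  have hpd : (Sig Z (psiPart (joinParam β ψ))).PosDef := by
    rw [psiPart_joinParam]; exact posDef_Sig Z h.hψ
  have hμ := isLinearMap_meanY (q := q) X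
  have hS := isLinearMap_Sig_psiPart (p := p) Z
  have hsy : ∀ θ : EuclideanSpace ℝ (Fin p ⊕ VarIdx q), (Sig Z (psiPart θ))ᵀ = Sig Z (psiPart θ) :=
    fun θ => Sig_transpose Z _
  obtain ⟨a, ha1, ha2⟩ := exists_inner_stdScore_eq hμ hS hsy hpd (h.posDef_info hX β) hu
  have hcont := continuous_inner_stdScore hμ hS hsy hpd u
  -- Unit variance gives even `F ≤ 2`; 4 is used so that the full and restricted cases share one
  -- rate.
  have hF : infoForm (Sig Z ψ) (Sig Z (psiPart a)) ≤ 4 := by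
    have := (posSemidef_real_iff.1 hpd.inv.posSemidef).2 (ofLp (meanY X a))
    simp only [psiPart_joinParam] at ha1 this
    linarith
  have hm0 : (0 : ℝ) < m := by exact_mod_cast h.hm
  have hC := clusterConst_pos h.hc₁ h.hc₂
  have hbound (x : ObsIdx n → ℝ) : |x ⬝ᵥ (Sig Z (psiPart a) *ᵥ x)| ≤
      √(4 * clusterConst c₁ c₂ / m) * (x ⬝ᵥ (Sig Z (psiPart (joinParam β ψ)) *ᵥ x)) := by
    rw [psiPart_joinParam]
    refine (h.abs_le (psiPart a) x).trans (mul_le_mul_of_nonneg_right (Real.sqrt_le_sqrt ?_)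
      ((posSemidef_real_iff.1 (posDef_Sig Z h.hψ).posSemidef).2 x))
    have := mul_le_mul_of_nonneg_left hF hC.le
    exact div_le_div_of_nonneg_right (by linarith) hm0.le
  obtain ⟨η, hη1, hη2⟩ := exists_integral_cexp_scoreForm_eq hpd (hsy a) (ofLp (meanY X a))
    (meanY X (joinParam β ψ)) ha1 hbound ht
  refine ⟨η, hη1, ?_⟩
  simp only [psiPart_joinParam] at ha2 hη2
  rw [← hη2]
  simp only [← ha2, WS]
  exact hlaw.integral_comp
    (f := fun y => cexp ((t * inner ℝ u (stdScore (meanY X) (fun θ' => Sig Z (psiPart θ'))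
      (joinParam β ψ) y) : ℝ) * I))
    (Continuous.aestronglyMeasurable (by fun_prop))

open Complex in
lemma IsRegularModel.exists_integral_cexp_WSR_eq {K : Type*} [Fintype K] [DecidableEq K]
    (h : IsRegularModel Z ψ c₁ c₂) {X : (i : Fin m) → Matrix (Fin (n i)) (Fin p) ℝ}
    {V : Matrix (ObsIdx n) K ℝ} (hV : Vᵀ * V = 1) (hVX : Vᵀ * stackX X = 0)
    (hle : ∀ a, infoForm (Sig Z ψ) (Sig Z a) ≤ 2 * infoForm (SigR V Z ψ) (SigR V Z a))
    {β : EuclideanSpace ℝ (Fin p)} {Y : (i : Fin m) → Ω → EuclideanSpace ℝ (Fin (n i))}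
    (hY : IsClusterModel P X Z β ψ Y) {v : EuclideanSpace ℝ (VarIdx q)} (hv : ‖v‖ = 1)
    {t : ℝ} (ht : |t| * √(4 * clusterConst c₁ c₂ / m) ≤ 1 / 2) :
    ∃ η : ℂ, ‖η‖ ≤ |t| ^ 3 * √(4 * clusterConst c₁ c₂ / m) ∧
      ∫ ω, cexp ((t * inner ℝ v (WSR V Z ψ (stackY fun i => Y i ω)) : ℝ) * I) ∂P =
        cexp (-(t ^ 2 / 2) + η) := by
  have hlaw : HasLaw (fun ω => toLp 2 (Vᵀ *ᵥ ofLp (stackY fun i => Y i ω)))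
      (multivariateGaussian 0 (SigR V Z ψ)) P := by
    have := hasLaw_mulVec_multivariateGaussian (posDef_Sig Z h.hψ).posSemidef
      (hY.hasLaw_stackY h.hψ) Vᵀ
    rw [transpose_transpose, ← SigR_eq hV] at this
    have h0 : Vᵀ *ᵥ ofLp (meanY X (joinParam β ψ)) = 0 := by
      rw [meanY, ofLp_toLp, mulVec_mulVec, hVX, zero_mulVec]
    rwa [h0, toLp_zero] at this
  have hpd := posDef_SigR hV Z h.hψ
  have hμ : IsLinearMap ℝ fun _ : EuclideanSpace ℝ (VarIdx q) => (0 : EuclideanSpace ℝ K) :=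
    ⟨fun _ _ => by simp, fun _ _ => by simp⟩
  have hS := isLinearMap_SigR hV Z
  have hsy := SigR_transpose hV Z
  obtain ⟨a, ha1, ha2⟩ := exists_inner_stdScore_eq hμ hS hsy hpd (h.posDef_infoR hV hle) hv
  have hcont := continuous_inner_stdScore hμ hS hsy hpd v
  -- Unit variance makes the restricted form equal to 2, and `hle` costs another factor 2.
  have hF : infoForm (Sig Z ψ) (Sig Z a) ≤ 4 := by
    have h1 := hle a
    simp only [ofLp_zero, zero_dotProduct, zero_add] at ha1
    linarith
  have hm0 : (0 : ℝ) < m := by exact_mod_cast h.hm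
  have hC := clusterConst_pos h.hc₁ h.hc₂
  have hbound (x : K → ℝ) : |x ⬝ᵥ (SigR V Z a *ᵥ x)| ≤
      √(4 * clusterConst c₁ c₂ / m) * (x ⬝ᵥ (SigR V Z ψ *ᵥ x)) := by
    refine (h.abs_SigR_le hV a x).trans (mul_le_mul_of_nonneg_right (Real.sqrt_le_sqrt ?_)
      ((posSemidef_real_iff.1 hpd.posSemidef).2 x))
    have := mul_le_mul_of_nonneg_left hF hC.le
    exact div_le_div_of_nonneg_right (by linarith) hm0.le
  obtain ⟨η, hη1, hη2⟩ := exists_integral_cexp_scoreForm_eq hpd (hsy a)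
    (ofLp (0 : EuclideanSpace ℝ K)) (0 : EuclideanSpace ℝ K) ha1 hbound ht
  refine ⟨η, hη1, ?_⟩
  rw [← hη2]
  simp only [← ha2, WSR]
  exact hlaw.integral_comp
    (f := fun y => cexp ((t * inner ℝ v (stdScore (fun _ => 0) (SigR V Z) ψ y) : ℝ) * I))
    (Continuous.aestronglyMeasurable (by fun_prop))

end Clusters

/-! ### From characteristic functions to convergence in distribution -/

section Limit

open Complex in
/-- Convergence to a standard normal distribution from an expansion of the characteristic
functions. -/
lemma tendstoInDistribution_gaussianReal_of_cexp {Ω : ℕ → Type*} [∀ m, MeasurableSpace (Ω m)]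
    {P : (m : ℕ) → Measure (Ω m)} [∀ m, IsProbabilityMeasure (P m)] {W : (m : ℕ) → Ω m → ℝ}
    (hW : ∀ m, AEMeasurable (W m) (P m)) {s : ℕ → ℝ} (hs : Tendsto s atTop (𝓝 0))
    (h : ∀ᶠ m in atTop, ∀ t : ℝ, |t| * s m ≤ 1 / 2 → ∃ η : ℂ, ‖η‖ ≤ |t| ^ 3 * s m ∧
      ∫ ω, cexp ((t * W m ω : ℝ) * I) ∂(P m) = cexp (-(t ^ 2 / 2) + η)) :
    TendstoInDistribution W atTop (id : ℝ → ℝ) P (gaussianReal 0 1) := by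
  refine ⟨hW, aemeasurable_id, ?_⟩
  refine ProbabilityMeasure.tendsto_of_tendsto_charFun fun t => ?_
  simp only [ProbabilityMeasure.coe_mk, Measure.map_id, charFun_gaussianReal]
  have hcf (m : ℕ) : charFun ((P m).map (W m)) t = ∫ ω, cexp ((t * W m ω : ℝ) * I) ∂(P m) := by
    rw [charFun_apply_real, integral_map (hW m) (Continuous.aestronglyMeasurable (by fun_prop))]
    simp
  simp_rw [hcf]
  have hst : Tendsto (fun m => |t| * s m) atTop (𝓝 0) := by simpa using hs.const_mul |t|
  have hev : ∀ᶠ m in atTop, ∃ η : ℂ, ‖η‖ ≤ |t| ^ 3 * s m ∧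
      ∫ ω, cexp ((t * W m ω : ℝ) * I) ∂(P m) = cexp (-(t ^ 2 / 2) + η) := by
    filter_upwards [h, hst.eventually (ge_mem_nhds (by norm_num : (0 : ℝ) < 1 / 2))] with m h1 h2
    exact h1 t h2
  choose! η hη using fun m => (fun hm => hm : (∃ η : ℂ, ‖η‖ ≤ |t| ^ 3 * s m ∧
      ∫ ω, cexp ((t * W m ω : ℝ) * I) ∂(P m) = cexp (-(t ^ 2 / 2) + η)) → _)
  have hη0 : Tendsto η atTop (𝓝 0) := by
    refine squeeze_zero_norm' (a := fun m => |t| ^ 3 * s m) (hev.mono fun m hm => (hη m hm).1) ?_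
    simpa using hs.const_mul (|t| ^ 3)
  have hlim : Tendsto (fun m => cexp (-(t ^ 2 / 2) + η m)) atTop
      (𝓝 (cexp (t * (0 : ℝ) * I - (1 : NNReal) * t ^ 2 / 2))) := by
    have e : (t : ℂ) * (0 : ℝ) * I - (1 : NNReal) * t ^ 2 / 2 = -(t ^ 2 / 2) + 0 := by simp
    rw [e]
    exact (continuous_exp.tendsto _).comp (hη0.const_add _)
  exact hlim.congr' (hev.mono fun m hm => (hη m hm).2.symm)

end Limit

end LMM

end

theorem corollary2
    {Ω : ℕ → Type*} [∀ m, MeasurableSpace (Ω m)]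
    (P : (m : ℕ) → Measure (Ω m)) [∀ m, IsProbabilityMeasure (P m)]
    -- dimensions: `p m` fixed effects, `q m` random effects per cluster, cluster sizes `n m i`
    (p q : ℕ → ℕ) (n : (m : ℕ) → Fin m → ℕ)
    (X : (m : ℕ) → (i : Fin m) → Matrix (Fin (n m i)) (Fin (p m)) ℝ)
    (Z : (m : ℕ) → (i : Fin m) → Matrix (Fin (n m i)) (Fin (q m)) ℝ)
    (β : (m : ℕ) → EuclideanSpace ℝ (Fin (p m)))
    (ψ : (m : ℕ) → EuclideanSpace ℝ (LMM.VarIdx (q m)))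
    (Y : (m : ℕ) → (i : Fin m) → Ω m → EuclideanSpace ℝ (Fin (n m i)))
    (hq : ∀ m, 1 ≤ m → 1 ≤ q m)
    (hψ : ∀ m, 1 ≤ m → ψ m ∈ LMM.paramSet (q m))
    (hY : ∀ m, 1 ≤ m → LMM.IsClusterModel (P m) (X m) (Z m) (β m) (ψ m) (Y m))
    -- (i) and (ii), with constants that do not depend on `m`
    (c₁ c₂ : ℝ) (hc₁ : 1 < c₁) (hc₂ : 1 < c₂)
    (h_i : ∀ m, 1 ≤ m → c₁ ≤ ((∑ i, (n m i : ℝ)) / m) / q m)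
    (h_ii : ∀ m, 1 ≤ m → ∀ i, ∀ γ ∈ spectrum ℝ ((Z m i)ᵀ * Z m i), c₂⁻¹ ≤ γ ∧ γ ≤ c₂)
    -- (iv) and (v)
    (h_iv : ∀ m, 1 ≤ m → (LMM.stackX (X m)).rank = p m)
    (h_v : (fun m => ‖ψ m‖ / LMM.errVar (ψ m)) =o[atTop] fun m : ℕ => (m : ℝ) ^ (1 / 2 : ℝ)) :
    ((∀ m, 1 ≤ m → (LMM.info (X m) (Z m) (LMM.joinParam (β m) (ψ m))).PosDef) ∧
      ∀ u : (m : ℕ) → EuclideanSpace ℝ (Fin (p m) ⊕ LMM.VarIdx (q m)),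
        (∀ m, 1 ≤ m → ‖u m‖ = 1) →
        TendstoInDistribution
          (fun (m : ℕ) (ω : Ω m) => inner ℝ (u m)
            (LMM.WS (X m) (Z m) (LMM.joinParam (β m) (ψ m)) (LMM.stackY fun i => Y m i ω)))
          atTop (id : ℝ → ℝ) P (gaussianReal 0 1)) ∧
    (Tendsto (fun m => (p m : ℝ) / m) atTop (𝓝 0) →
      -- `V m` is semi-orthogonal with `n - p` columns, which are orthogonal to those of `X`
      ∀ V : (m : ℕ) → Matrix (LMM.ObsIdx (n m)) (Fin ((∑ i, n m i) - p m)) ℝ,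
        (∀ m, 1 ≤ m → (V m)ᵀ * V m = 1 ∧ (V m)ᵀ * LMM.stackX (X m) = 0) →
        (∀ᶠ m in atTop, (LMM.infoR (V m) (Z m) (ψ m)).PosDef) ∧
        ∀ v : (m : ℕ) → EuclideanSpace ℝ (LMM.VarIdx (q m)),
          (∀ m, 1 ≤ m → ‖v m‖ = 1) →
          TendstoInDistribution
            (fun (m : ℕ) (ω : Ω m) => inner ℝ (v m)
              (LMM.WSR (V m) (Z m) (ψ m) (LMM.stackY fun i => Y m i ω)))
            atTop (id : ℝ → ℝ) P (gaussianReal 0 1)) := by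
  have hreg (m : ℕ) (hm : 1 ≤ m) : LMM.IsRegularModel (Z m) (ψ m) c₁ c₂ :=
    ⟨hm, hq m hm, hψ m hm, hc₁, hc₂, h_i m hm, h_ii m hm⟩
  have hs : Tendsto (fun m : ℕ => √(4 * LMM.clusterConst c₁ c₂ / m)) atTop (𝓝 0) := by
    have := (tendsto_const_div_atTop_nhds_zero_nat (4 * LMM.clusterConst c₁ c₂)).sqrt
    simpa using this
  have hstack (m : ℕ) : AEMeasurable (fun ω => LMM.stackY fun i => Y m i ω) (P m) := by
    -- The model is assumed only for `m ≥ 1`; at `m = 0` there are no observations and the stacked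
    -- vector is constant.
    rcases Nat.eq_zero_or_pos m with rfl | hm
    · have : (fun ω => LMM.stackY fun i => Y 0 i ω) =
          fun _ => LMM.stackY (fun i => i.elim0) := by
        funext ω
        congr 1
        funext i
        exact i.elim0
      rw [this]
      exact aemeasurable_const
    · exact ((hY m hm).hasLaw_stackY (hψ m hm)).aemeasurable
  refine ⟨⟨fun m hm => (hreg m hm).posDef_info (h_iv m hm) (β m), fun u hu => ?_⟩,
    fun hp V hV => ?_⟩
  · refine LMM.tendstoInDistribution_gaussianReal_of_cexp (fun m => ?_) hs ?_
    · rcases Nat.eq_zero_or_pos m with rfl | hm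
      · have : (fun ω => inner ℝ (u 0) (LMM.WS (X 0) (Z 0) (LMM.joinParam (β 0) (ψ 0))
            (LMM.stackY fun i => Y 0 i ω))) = fun _ => inner ℝ (u 0) (LMM.WS (X 0) (Z 0)
              (LMM.joinParam (β 0) (ψ 0)) (LMM.stackY (fun i => i.elim0))) := by
          funext ω
          congr 3
          funext i
          exact i.elim0
        rw [this]
        exact aemeasurable_const
      · have hc := LMM.continuous_inner_stdScore (LMM.isLinearMap_meanY (q := q m) (X m))
          (LMM.isLinearMap_Sig_psiPart (p := p m) (Z m)) (fun θ => LMM.Sig_transpose (Z m) _)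
          (θ := LMM.joinParam (β m) (ψ m))
          (by rw [LMM.psiPart_joinParam]; exact LMM.posDef_Sig (Z m) (hψ m hm)) (u m)
        exact hc.measurable.comp_aemeasurable (hstack m)
    · filter_upwards [eventually_ge_atTop 1] with m hm t ht
      exact (hreg m hm).exists_integral_cexp_WS_eq (h_iv m hm) (hY m hm) (hu m hm) ht
  · have hC := LMM.clusterConst_pos hc₁ hc₂
    have hsmall : ∀ᶠ m : ℕ in atTop, (p m : ℝ) / m * (4 * LMM.clusterConst c₁ c₂) ≤ 1 := by
      have := hp.mul_const (4 * LMM.clusterConst c₁ c₂)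
      rw [zero_mul] at this
      exact this.eventually (ge_mem_nhds one_pos)
    have hcard (m : ℕ) (hm : 1 ≤ m) : (Fintype.card (LMM.ObsIdx (n m)) : ℝ) -
        Fintype.card (Fin ((∑ i, n m i) - p m)) = p m := by
      -- Full column rank forces `p ≤ n`, so the truncated subtraction is the true codimension
      -- count.
      have hle : p m ≤ ∑ i, n m i := by
        have := Matrix.rank_le_card_height (LMM.stackX (X m))
        rw [h_iv m hm] at this
        simpa [Fintype.card_sigma] using this
      rw [Fintype.card_fin, Nat.cast_sub hle]
      simp [Fintype.card_sigma]
    have hle : ∀ᶠ m : ℕ in atTop, 1 ≤ m ∧ ∀ a,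
        LMM.infoForm (LMM.Sig (Z m) (ψ m)) (LMM.Sig (Z m) a) ≤
          2 * LMM.infoForm (LMM.SigR (V m) (Z m) (ψ m)) (LMM.SigR (V m) (Z m) a) := by
      filter_upwards [eventually_ge_atTop 1, hsmall] with m hm h1
      exact ⟨hm, (hreg m hm).infoForm_le_SigR (hV m hm).1 (hcard m hm) h1⟩
    refine ⟨hle.mono fun m hm => (hreg m hm.1).posDef_infoR (hV m hm.1).1 hm.2, fun v hv => ?_⟩
    refine LMM.tendstoInDistribution_gaussianReal_of_cexp (fun m => ?_) hs ?_
    · rcases Nat.eq_zero_or_pos m with rfl | hm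
      · have : (fun ω => inner ℝ (v 0) (LMM.WSR (V 0) (Z 0) (ψ 0)
            (LMM.stackY fun i => Y 0 i ω))) = fun _ => inner ℝ (v 0) (LMM.WSR (V 0) (Z 0)
              (ψ 0) (LMM.stackY (fun i => i.elim0))) := by
          funext ω
          congr 3
          funext i
          exact i.elim0
        rw [this]
        exact aemeasurable_const
      · have hc := LMM.continuous_inner_stdScore
          (μ := fun _ => (0 : EuclideanSpace ℝ (Fin ((∑ i, n m i) - p m))))
          ⟨fun _ _ => by simp, fun _ _ => by simp⟩
          (LMM.isLinearMap_SigR (hV m hm).1 (Z m)) (LMM.SigR_transpose (hV m hm).1 (Z m))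
          (LMM.posDef_SigR (hV m hm).1 (Z m) (hψ m hm)) (v m)
        have hmul : Continuous fun y : EuclideanSpace ℝ (LMM.ObsIdx (n m)) =>
            toLp 2 ((V m)ᵀ *ᵥ ofLp y) := by fun_prop
        exact (hc.comp hmul).measurable.comp_aemeasurable (hstack m)
    · filter_upwards [hle] with m hm t ht
      exact (hreg m hm.1).exists_integral_cexp_WSR_eq (hV m hm.1).1 (hV m hm.1).2 hm.2
        (hY m hm.1) (hv m hm.1) ht
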